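/- Let $U:\mathbb R\to\mathbb R$ satisfy condition U1: $U$ is smooth and even, and for some $a,m>0$ and some $k>1$ one has $U(\psi)>0$ for $\psi\neq\pm a$ and $U(\psi)=\frac{m^2}{2}(\psi\mp a)^2+O(|\psi\mp a|^{2k})$ as $\psi\to\pm a$. Put $F=-U'$, and let $s$ be the kink, i.e. the odd nonconstant finite-energy solution of $s''-U'(s)=0$ on $\mathbb R$ with $s(0)=0$ and $s(x)\to\pm a$ as $x\to\pm\infty$; put $S=(s,0)$. For $\sigma\in\mathbb R$ let $\|f\|_{L^2_\sigma}=\|(1+|x|)^\sigma f\|_{L^2(\mathbb R)}$ and $\|f\|_{H^1_\sigma}=\|f\|_{L^2_\sigma}+\|f'\|_{L^2_\sigma}$, and let $E_\sigma=H^1_\sigma\oplus L^2_\sigma$ be the space of pairs $(\Psi,\Pi)$ of odd functions with finite norm $\|(\Psi,\Pi)\|_{E_\sigma}=\|\Psi\|_{H^1_\sigma}+\|\Pi\|_{L^2_\sigma}$. Write $E=E_0$, and let $\mathcal E=S+E$ have the metric $\|Y_1-Y_2\|_{E}$. Then for every $\nu>0$ and every $d_0$ there is a constant $C(d_0)$ (which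 may also depend on $U$ and $\nu$) such that the following holds. If $Y=(\psi,\pi)\in C(\mathbb R,\mathcal E)$ solves $$\dot\psi=\pi,\qquad \dot\pi=\psi''+F(\psi)$$ in the sense of distributions, and the initial perturbation $X_0=Y(0)-S$ lies in $E_{5/2+\nu}$ with $\|X_0\|_{E_{5/2+\nu}}\le d_0$, then $\Psi(t)=\psi(\cdot,t)-s$ satisfies $$\|\Psi(t)\|_{L^2_{5/2+\nu}}\le C(d_0)(1+t)^{4+\nu},\qquad t>0.$$ -/

import Mathlib

open MeasureTheory Filter Topology Asymptotics
open scoped ENNReal ContDiff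

namespace KinkStability

/-- Condition **U1** with parameters `a, m > 0` and `k`: the potential `U` is a smooth even real
function, positive away from `±a`, and
`U(ψ) = (m²/2) (ψ ∓ a)² + O(|ψ ∓ a|^(2k))` as `ψ → ±a`. -/
structure ConditionU1 (U : ℝ → ℝ) (a m k : ℝ) : Prop where
  smooth : ContDiff ℝ ∞ U
  even : ∀ y, U (-y) = U y
  a_pos : 0 < a
  m_pos : 0 < m
  pos : ∀ y, y ≠ a → y ≠ -a → 0 < U y
  right_well : (fun y => U y - m ^ 2 / 2 * (y - a) ^ 2) =O[𝓝 a] fun y => |y - a| ^ (2 * k)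
  left_well : (fun y => U y - m ^ 2 / 2 * (y + a) ^ 2) =O[𝓝 (-a)] fun y => |y + a| ^ (2 * k)

/-- The nonlinearity `F = -U'`. -/
noncomputable def force (U : ℝ → ℝ) (y : ℝ) : ℝ := -deriv U y

/-- `s` is the kink: an odd, nonconstant, finite energy (classical) solution of `s'' - U'(s) = 0`
with `s(0) = 0` and `s(x) → ±a` as `x → ±∞` (nonconstancy follows from the limits as `a > 0`). -/
structure IsKink (U : ℝ → ℝ) (a : ℝ) (s : ℝ → ℝ) : Prop where
  smooth : ContDiff ℝ 2 s
  stationary : ∀ x, deriv (deriv s) x - deriv U (s x) = 0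
  odd : ∀ x, s (-x) = -s x
  zero : s 0 = 0
  tendsto_atTop : Tendsto s atTop (𝓝 a)
  tendsto_atBot : Tendsto s atBot (𝓝 (-a))
  finite_energy : Integrable fun x => (deriv s x) ^ 2 / 2 + U (s x)

/-- `g` is the weak (distributional) derivative of `f` on `ℝ`. -/
def HasWeakDeriv (f g : ℝ → ℝ) : Prop :=
  LocallyIntegrable f ∧ LocallyIntegrable g ∧
    ∀ φ : ℝ → ℝ, ContDiff ℝ ∞ φ → HasCompactSupport φ →
      ∫ x, f x * deriv φ x = -∫ x, g x * φ x

/-- Multiplication by the weight `(1 + |x|)^σ`. -/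
noncomputable def weighted (σ : ℝ) (f : ℝ → ℝ) (x : ℝ) : ℝ := (1 + |x|) ^ σ * f x

/-- The norm of `L²_σ`, with values in `[0, ∞]`. -/
noncomputable def normL2 (σ : ℝ) (f : ℝ → ℝ) : ℝ≥0∞ := eLpNorm (weighted σ f) 2 volume

/-- The norm `‖f‖_{L²_σ} + ‖f'‖_{L²_σ}` of `H¹_σ`, with values in `[0, ∞]`. The weak derivative `f'`
is unique up to null sets, so the infimum runs over a single value; it is `∞` if `f` has no weak
derivative. -/
noncomputable def normH1 (σ : ℝ) (f : ℝ → ℝ) : ℝ≥0∞ :=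
  ⨅ (g : ℝ → ℝ) (_ : HasWeakDeriv f g), normL2 σ f + normL2 σ g

/-- The norm of `E_σ = H¹_σ ⊕ L²_σ`. -/
noncomputable def normE (σ : ℝ) (ψ π : ℝ → ℝ) : ℝ≥0∞ := normH1 σ ψ + normL2 σ π

/-- The function (or rather its class modulo null sets) is odd. -/
def IsOdd (f : ℝ → ℝ) : Prop := ∀ᵐ x, f (-x) = -f x

/-- `(ψ, π)` belongs to the space `E_σ = H¹_σ ⊕ L²_σ` of odd states. -/
structure MemE (σ : ℝ) (ψ π : ℝ → ℝ) : Prop where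
  odd_fst : IsOdd ψ
  odd_snd : IsOdd π
  mem_fst : MemLp (weighted σ ψ) 2 volume
  mem_deriv : ∃ g, HasWeakDeriv ψ g ∧ MemLp (weighted σ g) 2 volume
  mem_snd : MemLp (weighted σ π) 2 volume

/-- `Y(t) = (ψ(t), π(t))`, `t ∈ ℝ`, is a solution of `ψ̇ = π`, `π̇ = ψ'' + F(ψ)` (in the sense
of distributions on `ℝ_t × ℝ_x`) of class `C(ℝ, S + E)`, where `S = (s, 0)`, `E = E_0`, and the
metric of `S + E` is `‖Y₁ - Y₂‖_E`. The first argument of `ψ`, `π` and of the test functions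
is the time. -/
structure IsSolution (U s : ℝ → ℝ) (ψ π : ℝ → ℝ → ℝ) : Prop where
  mem_phase : ∀ t, MemE 0 (fun x => ψ t x - s x) (π t)
  continuous : ∀ t₀, Tendsto
    (fun t => normE 0 (fun x => ψ t x - ψ t₀ x) (fun x => π t x - π t₀ x)) (𝓝 t₀) (𝓝 0)
  eq_fst : ∀ φ : ℝ × ℝ → ℝ, ContDiff ℝ ∞ φ → HasCompactSupport φ →
    -∫ t, ∫ x, ψ t x * deriv (fun τ => φ (τ, x)) t = ∫ t, ∫ x, π t x * φ (t, x)
  eq_snd : ∀ φ : ℝ × ℝ → ℝ, ContDiff ℝ ∞ φ → HasCompactSupport φ →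
    -∫ t, ∫ x, π t x * deriv (fun τ => φ (τ, x)) t =
      ∫ t, ∫ x, (ψ t x * iteratedDeriv 2 (fun y => φ (t, y)) x + force U (ψ t x) * φ (t, x))

end KinkStability

/-! The estimate is a weighted energy inequality for the full nonlinear energy; no linearization
about the kink is used. Let `e = ψ̇²/2 + ψ'²/2 + U(ψ)`. Since `U ≥ 0`, the energy flux `ψ̇ψ'` is
bounded by `e`, so `∫ W e` does not increase for any nonnegative cut-off weight with `W_t + |W_x| ≤
0`. With `⟨x⟩ = (1 + x²)^(1/2)`, the weight `(⟨x⟩ + T - t)^P` is of this kind: it equals `⟨x⟩^P` at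
`t = T` and is at most `(1 + T)^P ⟨x⟩^P` at `t = 0`. Hence `∫ ⟨x⟩^P π(T)²` is at most a constant
times `(1 + T)^P` times the initial weighted energy. Taking `P = 2σ` with `σ = 5/2 + ν` and
integrating `ψ̇ = π` in time, the displacement `ψ(T) - ψ(0)` has `L²_σ` norm of order `T (1 + T)^σ`,
apart from an additive error of order `T`. The power obtained is `7/2 + ν`, half a power better than
needed.

The initial weighted energy is finite because `U` vanishes quadratically at the wells, so that
`U(ψ(0))` is bounded by the squares of the perturbation and of the distance of the kink to the
wells. That distance decays exponentially (`IsKink.exists_exp_decay`), and `s'² = 2U(s)` controls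
`s'` as well. All constants depend only on `U`, `s`, `ν` and `d₀` (`exists_initialBound`).

A finite-energy solution is too rough to differentiate `e`, so it is mollified in space. The
mollified pair solves the equation classically except that `ρ * F(ψ)` replaces `F(ρ * ψ)`; as `ψ` is
1/2-Hölder, the two differ by `O(√ε)`. The implied constant depends on the solution and on the time
interval, which is harmless: the weight is cut off at distance `N`, the scale `ε` is sent to zero
for fixed `N`, and `N → ∞` is taken by Fatou's lemma. The carriers are `weighted_energy_le`,
`coneWeightT_add_abs_le`, `RegularSolution.mol_energy_le` and
`RegularSolution.lintegral_displacement_le`; `IsSolution.exists_regularSolution` connects them with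
distributional solutions. -/

namespace KinkStability

/-! ### Mollification and weak derivatives on the line -/

section Mollification

/-- The convolution of `f` with the kernel `η`. -/
noncomputable def mol (η f : ℝ → ℝ) (x : ℝ) : ℝ := ∫ y, f y * η (x - y)

lemma mol_eq_convolution (η f : ℝ → ℝ) :
    mol η f = convolution f η (ContinuousLinearMap.mul ℝ ℝ) volume := by
  ext x
  rw [convolution_mul, mol]

lemma hasDerivAt_mol {η f : ℝ → ℝ} (hf : LocallyIntegrable f) (hη : ContDiff ℝ ∞ η)
    (hc : HasCompactSupport η) (x : ℝ) : HasDerivAt (mol η f) (mol (deriv η) f x) x := by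
  rw [mol_eq_convolution, mol_eq_convolution]
  exact hc.hasDerivAt_convolution_right _ hf (hη.of_le (by simp)) x

lemma continuous_mol {η f : ℝ → ℝ} (hf : LocallyIntegrable f) (hη : Continuous η)
    (hc : HasCompactSupport η) : Continuous (mol η f) := by
  rw [mol_eq_convolution]
  exact hc.continuous_convolution_right _ hf hη

lemma hasCompactSupport_comp_sub {η : ℝ → ℝ} (hc : HasCompactSupport η) (x : ℝ) :
    HasCompactSupport fun y => η (x - y) :=
  hc.comp_homeomorph (Homeomorph.subLeft x)

lemma integrable_mul_kernel {η f : ℝ → ℝ} (hf : LocallyIntegrable f) (hη : Continuous η)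
    (hc : HasCompactSupport η) (x : ℝ) : Integrable fun y => f y * η (x - y) := by
  have := hf.integrable_smul_right_of_hasCompactSupport (g := fun y => η (x - y)) (by fun_prop)
    (hasCompactSupport_comp_sub hc x)
  simpa using this

lemma deriv_comp_sub (η : ℝ → ℝ) (x y : ℝ) :
    deriv (fun z => η (x - z)) y = -deriv η (x - y) := by
  rw [deriv_comp_const_sub]

/-- Test the weak derivative against `y ↦ η (x - y)`; the sign from reflecting the kernel cancels
the one in the definition. -/
lemma mol_deriv_of_hasWeakDeriv {f g η : ℝ → ℝ} (h : HasWeakDeriv f g) (hη : ContDiff ℝ ∞ η)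
    (hc : HasCompactSupport η) (x : ℝ) : mol (deriv η) f x = mol η g x := by
  have := h.2.2 (fun y => η (x - y)) (by fun_prop) (hasCompactSupport_comp_sub hc x)
  simp only [deriv_comp_sub, mul_neg, integral_neg, neg_inj] at this
  exact this

/-- `ρ` is a smooth mollifier supported in `[-ε, ε]`. -/
structure IsMollifier (ρ : ℝ → ℝ) (ε : ℝ) : Prop where
  smooth : ContDiff ℝ ∞ ρ
  compact : HasCompactSupport ρ
  nonneg : ∀ x, 0 ≤ ρ x
  integral : ∫ x, ρ x = 1
  support : ∀ x, ε < |x| → ρ x = 0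

lemma isMollifier_normed (φ : ContDiffBump (0 : ℝ)) : IsMollifier (φ.normed volume) φ.rOut where
  smooth := φ.contDiff_normed
  compact := φ.hasCompactSupport_normed
  nonneg := φ.nonneg_normed
  integral := φ.integral_normed
  support x hx := by
    have : x ∉ Function.support (φ.normed volume) := by
      rw [φ.support_normed_eq]
      simp [hx.le]
    simpa using this

lemma exists_isMollifier {ε : ℝ} (hε : 0 < ε) : ∃ ρ, IsMollifier ρ ε :=
  ⟨_, isMollifier_normed ⟨ε / 2, ε, by positivity, by linarith⟩⟩

lemma exists_mollifiers : ∃ ρ : ℕ → ℝ → ℝ, (∀ n, ∃ ε, IsMollifier (ρ n) ε) ∧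
    ∀ f : ℝ → ℝ, LocallyIntegrable f →
      ∀ᵐ x, Tendsto (fun n => mol (ρ n) f x) atTop (𝓝 (f x)) := by
  let φ : ℕ → ContDiffBump (0 : ℝ) := fun n =>
    ⟨1 / (n + 1) / 2, 1 / (n + 1), by positivity, by
      have : (0 : ℝ) < 1 / (n + 1) := by positivity
      linarith⟩
  refine ⟨fun n => (φ n).normed volume, fun n => ⟨_, isMollifier_normed (φ n)⟩, fun f hf => ?_⟩
  -- Almost everywhere convergence for merely locally integrable `f` needs a bounded ratio of outer
  -- to inner radius; here it is 2.
  have := ContDiffBump.ae_convolution_tendsto_right_of_locallyIntegrable (φ := φ) (l := atTop)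
    (K := 2) tendsto_one_div_add_atTop_nhds_zero_nat (Eventually.of_forall fun n => by
      simp only [φ]; linarith) hf
  filter_upwards [this] with x hx
  refine hx.congr fun n => ?_
  rw [convolution_lsmul_swap, mol]
  simp [mul_comm]

/-- Du Bois-Reymond's lemma: every mollification has zero derivative, hence is constant, and the
constants converge to `f` almost everywhere. -/
lemma ae_const_of_integral_deriv_eq_zero {f : ℝ → ℝ} (hf : LocallyIntegrable f)
    (h : ∀ φ : ℝ → ℝ, ContDiff ℝ ∞ φ → HasCompactSupport φ → ∫ x, f x * deriv φ x = 0) :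
    ∃ c, ∀ᵐ x, f x = c := by
  obtain ⟨ρ, hρ, hlim⟩ := exists_mollifiers
  have hw : HasWeakDeriv f 0 := ⟨hf, locallyIntegrable_const 0, fun φ h1 h2 => by
    simp [h φ h1 h2]⟩
  have hconst : ∀ n x y, mol (ρ n) f x = mol (ρ n) f y := by
    intro n
    obtain ⟨ε, hε⟩ := hρ n
    have hd := hasDerivAt_mol hf hε.smooth hε.compact
    refine is_const_of_deriv_eq_zero (fun x => (hd x).differentiableAt) fun x => ?_
    rw [(hd x).deriv, mol_deriv_of_hasWeakDeriv hw hε.smooth hε.compact]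
    simp [mol]
  obtain ⟨x₀, hx₀⟩ := (hlim f hf).exists
  refine ⟨f x₀, ?_⟩
  filter_upwards [hlim f hf] with x hx
  exact tendsto_nhds_unique hx (hx₀.congr fun n => hconst n _ _)

lemma intervalIntegrable_of_locallyIntegrable {g : ℝ → ℝ} (hg : LocallyIntegrable g) (a b : ℝ) :
    IntervalIntegrable g volume a b :=
  (hg.integrableOn_isCompact isCompact_uIcc).intervalIntegrable

/-- As `g` is only locally integrable, integration by parts is done for absolutely continuous
functions, with the almost everywhere derivative of the primitive. -/
lemma integral_primitive_mul_deriv {g : ℝ → ℝ} (hg : LocallyIntegrable g) {φ : ℝ → ℝ}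
    (hφ : ContDiff ℝ ∞ φ) (hc : HasCompactSupport φ) :
    ∫ x, (∫ y in (0 : ℝ)..x, g y) * deriv φ x = -∫ x, g x * φ x := by
  obtain ⟨R, hR, hRs⟩ : ∃ R > 0, ∀ x, R ≤ |x| → φ x = 0 := by
    obtain ⟨R, hR, h⟩ := hc.exists_pos_le_norm
    exact ⟨R, hR, fun x hx => h x hx⟩
  have hsupp : Function.support φ ⊆ Set.Ioc (-R) R := by
    intro x hx
    have : |x| < R := by
      by_contra! hcon
      exact hx (hRs x hcon)
    rw [abs_lt] at this
    exact ⟨this.1, this.2.le⟩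
  have hsupp' : Function.support (deriv φ) ⊆ Set.Icc (-R) R := by
    refine (support_deriv_subset).trans (closure_minimal ?_ isClosed_Icc)
    exact hsupp.trans Set.Ioc_subset_Icc_self
  have hI : IntervalIntegrable g volume (-R) R :=
    intervalIntegrable_of_locallyIntegrable hg _ _
  have hG := hI.absolutelyContinuousOnInterval_intervalIntegral (c := 0) (by
    rw [Set.uIcc_of_le (by linarith)]; constructor <;> linarith)
  have hφ' : AbsolutelyContinuousOnInterval φ (-R) R :=
    ContDiffOn.absolutelyContinuousOnInterval (hφ.of_le (by simp)).contDiffOn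
  have key := hG.integral_mul_deriv_eq_deriv_mul hφ'
  rw [hRs R (le_abs_self R), hRs (-R) (by rw [abs_neg]; exact le_abs_self R)] at key
  have e1 : ∫ x, (∫ y in (0 : ℝ)..x, g y) * deriv φ x
      = ∫ x in (-R)..R, (∫ y in (0 : ℝ)..x, g y) * deriv φ x := by
    rw [intervalIntegral.integral_of_le (by linarith), ← integral_Icc_eq_integral_Ioc,
      setIntegral_eq_integral_of_forall_compl_eq_zero]
    intro x hx
    have : deriv φ x = 0 := by
      by_contra hcon
      exact hx (hsupp' hcon)
    simp [this]
  have e2 : ∫ x, g x * φ x = ∫ x in (-R)..R, deriv (fun z => ∫ y in (0 : ℝ)..z, g y) x * φ x := by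
    rw [intervalIntegral.integral_of_le (by linarith),
      ← setIntegral_eq_integral_of_forall_compl_eq_zero (s := Set.Ioc (-R) R)]
    · refine setIntegral_congr_ae measurableSet_Ioc ?_
      filter_upwards [_root_.LocallyIntegrable.ae_hasDerivAt_integral hg] with x hx _
      rw [(hx 0).deriv]
    · intro x hx
      have : φ x = 0 := by
        by_contra hcon
        exact hx (hsupp hcon)
      simp [this]
  rw [e1, e2, key]
  simp

lemma HasWeakDeriv.exists_ae_eq {f g : ℝ → ℝ} (h : HasWeakDeriv f g) :
    ∃ c, ∀ᵐ x, f x = c + ∫ y in (0 : ℝ)..x, g y := by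
  have hcont : Continuous fun x => ∫ y in (0 : ℝ)..x, g y :=
    intervalIntegral.continuous_primitive (intervalIntegrable_of_locallyIntegrable h.2.1) 0
  obtain ⟨c, hc⟩ := ae_const_of_integral_deriv_eq_zero
    (f := fun x => f x - ∫ y in (0 : ℝ)..x, g y) (h.1.sub hcont.locallyIntegrable) (by
      intro φ hφ hφc
      have hd : Continuous (deriv φ) := hφ.continuous_deriv (by simp)
      have i1 : Integrable fun x => f x * deriv φ x := by
        simpa using h.1.integrable_smul_right_of_hasCompactSupport hd hφc.deriv
      have i2 : Integrable fun x => (∫ y in (0 : ℝ)..x, g y) * deriv φ x := by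
        simpa using hcont.locallyIntegrable.integrable_smul_right_of_hasCompactSupport hd hφc.deriv
      simp only [sub_mul]
      rw [integral_sub i1 i2, h.2.2 φ hφ hφc, integral_primitive_mul_deriv h.2.1 hφ hφc, sub_self])
  refine ⟨c, ?_⟩
  filter_upwards [hc] with x hx
  linarith

/-- Used in the time variable: it turns the equations tested in space from distributional into
classical ones. -/
lemma HasWeakDeriv.hasDerivAt {f g : ℝ → ℝ} (h : HasWeakDeriv f g) (hf : Continuous f)
    (hg : Continuous g) (x : ℝ) : HasDerivAt f (g x) x := by
  obtain ⟨c, hc⟩ := h.exists_ae_eq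
  have hcont : Continuous fun x => ∫ y in (0 : ℝ)..x, g y :=
    intervalIntegral.continuous_primitive (intervalIntegrable_of_locallyIntegrable h.2.1) 0
  have : f = fun x => c + ∫ y in (0 : ℝ)..x, g y :=
    (Continuous.ae_eq_iff_eq volume hf (by fun_prop)).1 hc
  rw [this]
  exact (intervalIntegral.integral_hasDerivAt_right (hg.intervalIntegrable _ _)
    hg.aestronglyMeasurable.stronglyMeasurableAtFilter hg.continuousAt).const_add c

end Mollification

/-! ### Cauchy–Schwarz, Hölder and sup bounds -/

section SquareIntegrals

lemma sq_lintegral_mul_le {α : Type*} [MeasurableSpace α] (μ : Measure α) {f g : α → ℝ≥0∞}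
    (hf : AEMeasurable f μ) (hg : AEMeasurable g μ) :
    (∫⁻ x, f x * g x ∂μ) ^ 2 ≤ (∫⁻ x, f x ^ 2 ∂μ) * ∫⁻ x, g x ^ 2 ∂μ := by
  have h := ENNReal.lintegral_mul_le_Lp_mul_Lq μ Real.HolderConjugate.two_two hf hg
  have h2 := pow_le_pow_left' h 2
  rw [mul_pow] at h2
  have e : ∀ a : ℝ≥0∞, (a ^ (2 : ℝ)⁻¹) ^ 2 = a := fun a => by
    rw [← ENNReal.rpow_natCast, ← ENNReal.rpow_mul]; norm_num
  simpa [e] using h2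

lemma enorm_integral_mul_sq_le {α : Type*} [MeasurableSpace α] (μ : Measure α) {f g : α → ℝ}
    (hf : AEStronglyMeasurable f μ) (hg : AEStronglyMeasurable g μ) :
    ‖∫ x, f x * g x ∂μ‖ₑ ^ 2 ≤ (∫⁻ x, ‖f x‖ₑ ^ 2 ∂μ) * ∫⁻ x, ‖g x‖ₑ ^ 2 ∂μ := by
  refine le_trans (pow_le_pow_left' (enorm_integral_le_lintegral_enorm _) 2) ?_
  simp only [enorm_mul]
  exact sq_lintegral_mul_le μ hf.enorm hg.enorm

lemma enorm_sq_eq_ofReal (x : ℝ) : ‖x‖ₑ ^ 2 = ENNReal.ofReal (x ^ 2) := by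
  rw [Real.enorm_eq_ofReal_abs, ← ENNReal.ofReal_pow (abs_nonneg x), sq_abs]

lemma intervalIntegral_sq_le {g : ℝ → ℝ} (hg : LocallyIntegrable g) {B : ℝ} (hB : 0 ≤ B)
    (h : ∫⁻ x, ‖g x‖ₑ ^ 2 ≤ ENNReal.ofReal B) (x y : ℝ) :
    (∫ z in x..y, g z) ^ 2 ≤ B * |y - x| := by
  have key := enorm_integral_mul_sq_le (volume.restrict (Set.uIoc x y)) (f := g) (g := fun _ => 1)
    hg.aestronglyMeasurable.restrict aestronglyMeasurable_const
  have e : (∫ z in x..y, g z) ^ 2 = (∫ z in Set.uIoc x y, g z * 1) ^ 2 := by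
    rw [← sq_abs, intervalIntegral.abs_integral_eq_abs_integral_uIoc, sq_abs]
    simp
  rw [e]
  rw [enorm_sq_eq_ofReal] at key
  have h1 : ∫⁻ z in Set.uIoc x y, ‖g z‖ₑ ^ 2 ≤ ENNReal.ofReal B :=
    (setLIntegral_le_lintegral _ _).trans h
  have h2 : ∫⁻ _ in Set.uIoc x y, ‖(1 : ℝ)‖ₑ ^ 2 = ENNReal.ofReal |y - x| := by
    simp [Real.volume_uIoc]
  rw [h2] at key
  have := key.trans (mul_le_mul_left h1 _)
  rw [← ENNReal.ofReal_mul hB] at this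
  exact (ENNReal.ofReal_le_ofReal_iff (by positivity)).1 this

/-- The embedding of functions with square integrable derivative into 1/2-Hölder functions:
Cauchy–Schwarz on the integral of the derivative. The later regularity of `ψ` rests on this. -/
lemma HasWeakDeriv.exists_holder {f g : ℝ → ℝ} (h : HasWeakDeriv f g) {B : ℝ} (hB : 0 ≤ B)
    (hg : ∫⁻ x, ‖g x‖ₑ ^ 2 ≤ ENNReal.ofReal B) :
    ∃ f' : ℝ → ℝ, (∀ᵐ x, f x = f' x) ∧ ∀ x y, (f' x - f' y) ^ 2 ≤ B * |x - y| := by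
  obtain ⟨c, hc⟩ := h.exists_ae_eq
  refine ⟨_, hc, fun x y => ?_⟩
  have i := intervalIntegrable_of_locallyIntegrable h.2.1
  rw [add_sub_add_left_eq_sub, intervalIntegral.integral_interval_sub_left (i _ _) (i _ _)]
  exact intervalIntegral_sq_le h.2.1 hB hg y x

lemma continuous_of_holder {f : ℝ → ℝ} {B : ℝ}
    (h : ∀ x y, (f x - f y) ^ 2 ≤ B * |x - y|) : Continuous f := by
  rw [continuous_iff_continuousAt]
  intro y
  have h1 : Tendsto (fun x => √(B * |x - y|)) (𝓝 y) (𝓝 0) := by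
    have : Continuous fun x => √(B * |x - y|) := by fun_prop
    simpa using this.tendsto y
  rw [ContinuousAt, tendsto_iff_dist_tendsto_zero]
  refine squeeze_zero (fun _ => dist_nonneg) (fun x => ?_) h1
  rw [Real.dist_eq, ← Real.sqrt_sq_eq_abs]
  exact Real.sqrt_le_sqrt (h x y)

/-- Average `f x ^ 2 ≤ 2 * f y ^ 2 + 2 * B` over `y ∈ [x, x + 1]`. -/
lemma sq_le_of_holder {f : ℝ → ℝ} {A B : ℝ} (hA : 0 ≤ A) (hB : 0 ≤ B)
    (h : ∀ x y, (f x - f y) ^ 2 ≤ B * |x - y|) (hf : ∫⁻ x, ‖f x‖ₑ ^ 2 ≤ ENNReal.ofReal A)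
    (x : ℝ) : f x ^ 2 ≤ 2 * A + 2 * B := by
  have hc := continuous_of_holder h
  have h1 : ∀ y ∈ Set.Icc x (x + 1),
      ENNReal.ofReal (f x ^ 2) ≤ 2 * ‖f y‖ₑ ^ 2 + ENNReal.ofReal (2 * B) := by
    intro y hy
    rw [enorm_sq_eq_ofReal, ← ENNReal.ofReal_ofNat 2, ← ENNReal.ofReal_mul (by norm_num),
      ← ENNReal.ofReal_add (by positivity) (by positivity)]
    apply ENNReal.ofReal_le_ofReal
    have h2 := h x y
    have h3 : |x - y| ≤ 1 := by rw [abs_le]; constructor <;> linarith [hy.1, hy.2]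
    have h4 : B * |x - y| ≤ B := by nlinarith
    nlinarith [sq_nonneg (f x - 2 * f y)]
  have h2 : ENNReal.ofReal (f x ^ 2) ≤ ENNReal.ofReal (2 * A + 2 * B) := by
    calc ENNReal.ofReal (f x ^ 2) = ∫⁻ _ in Set.Icc x (x + 1), ENNReal.ofReal (f x ^ 2) := by simp
      _ ≤ ∫⁻ y in Set.Icc x (x + 1), (2 * ‖f y‖ₑ ^ 2 + ENNReal.ofReal (2 * B)) :=
          setLIntegral_mono (by fun_prop) h1
      _ = 2 * (∫⁻ y in Set.Icc x (x + 1), ‖f y‖ₑ ^ 2) + ENNReal.ofReal (2 * B) := by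
          rw [lintegral_add_right _ measurable_const, lintegral_const_mul _ (by fun_prop)]
          simp
      _ ≤ 2 * ENNReal.ofReal A + ENNReal.ofReal (2 * B) := by
          gcongr
          exact (setLIntegral_le_lintegral _ _).trans hf
      _ = _ := by
          rw [← ENNReal.ofReal_ofNat 2, ← ENNReal.ofReal_mul (by norm_num),
            ← ENNReal.ofReal_add (by positivity) (by positivity)]
  exact (ENNReal.ofReal_le_ofReal_iff (by positivity)).1 h2

end SquareIntegrals

/-! ### Bounds and joint continuity for mollified functions -/

section MollifierEstimates

lemma enorm_mol_sq_le {η f : ℝ → ℝ} (hf : LocallyIntegrable f) (hη : Continuous η) (x : ℝ) :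
    ‖mol η f x‖ₑ ^ 2 ≤ (∫⁻ y, ‖f y‖ₑ ^ 2) * ∫⁻ y, ‖η y‖ₑ ^ 2 := by
  have h := enorm_integral_mul_sq_le volume (f := f) (g := fun y => η (x - y))
    hf.aestronglyMeasurable (by fun_prop)
  rwa [lintegral_sub_left_eq_self (fun y => ‖η y‖ₑ ^ 2) x] at h

lemma lintegral_enorm_sq_lt_top {η : ℝ → ℝ} (hη : Continuous η) (hc : HasCompactSupport η) :
    ∫⁻ y, ‖η y‖ₑ ^ 2 < ⊤ := by
  have : Integrable fun y => η y * η y :=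
    (hη.mul hη).integrable_of_hasCompactSupport hc.mul_left
  have h := this.2
  rw [hasFiniteIntegral_iff_enorm] at h
  simpa [sq] using h

lemma mol_sub {η f g : ℝ → ℝ} (hf : LocallyIntegrable f) (hg : LocallyIntegrable g)
    (hη : Continuous η) (hc : HasCompactSupport η) (x : ℝ) :
    mol η (fun y => f y - g y) x = mol η f x - mol η g x := by
  simp only [mol, sub_mul]
  exact integral_sub (integrable_mul_kernel hf hη hc x) (integrable_mul_kernel hg hη hc x)

/-- By Cauchy–Schwarz, `L²` continuity in time gives continuity of the mollification in time
uniformly in space, which combines with continuity in space at a fixed time. -/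
lemma continuous_mol_uncurry {η : ℝ → ℝ} (hη : Continuous η) (hc : HasCompactSupport η)
    {k : ℝ → ℝ → ℝ} (hk : ∀ t, LocallyIntegrable (k t))
    (hcont : ∀ t₀, Tendsto (fun t => ∫⁻ x, ‖k t x - k t₀ x‖ₑ ^ 2) (𝓝 t₀) (𝓝 0)) :
    Continuous fun p : ℝ × ℝ => mol η (k p.1) p.2 := by
  rw [continuous_iff_continuousAt]
  rintro ⟨t₀, x₀⟩
  have h1 : Tendsto (fun p : ℝ × ℝ => mol η (k t₀) p.2) (𝓝 (t₀, x₀)) (𝓝 (mol η (k t₀) x₀)) :=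
    ((continuous_mol (hk t₀) hη hc).comp continuous_snd).tendsto (t₀, x₀)
  have h2 : Tendsto (fun p : ℝ × ℝ => mol η (fun y => k p.1 y - k t₀ y) p.2) (𝓝 (t₀, x₀))
      (𝓝 0) := by
    have h3 : Tendsto (fun p : ℝ × ℝ =>
        (∫⁻ x, ‖k p.1 x - k t₀ x‖ₑ ^ 2) * ∫⁻ y, ‖η y‖ₑ ^ 2) (𝓝 (t₀, x₀)) (𝓝 0) := by
      have := ENNReal.Tendsto.mul_const (b := ∫⁻ y, ‖η y‖ₑ ^ 2)
        ((hcont t₀).comp (continuous_fst.tendsto (t₀, x₀)))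
        (Or.inr (lintegral_enorm_sq_lt_top hη hc).ne)
      simpa using this
    have h4 := tendsto_of_tendsto_of_tendsto_of_le_of_le tendsto_const_nhds h3
      (fun _ => zero_le) (fun p : ℝ × ℝ => enorm_mol_sq_le ((hk p.1).sub (hk t₀)) hη p.2)
    have h5 := (ENNReal.continuous_rpow_const (y := 1 / 2)).tendsto 0 |>.comp h4
    rw [ENNReal.zero_rpow_of_pos (by norm_num)] at h5
    rw [tendsto_zero_iff_enorm_tendsto_zero]
    refine h5.congr fun p => ?_
    simp only [Function.comp]
    rw [← ENNReal.rpow_natCast, ← ENNReal.rpow_mul]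
    norm_num
    rfl
  have h6 := h2.add h1
  rw [zero_add] at h6
  refine h6.congr fun p => ?_
  rw [mol_sub (hk _) (hk _) hη hc]
  ring

namespace IsMollifier

variable {ρ : ℝ → ℝ} {ε : ℝ}

lemma integral_comp_sub (hρ : IsMollifier ρ ε) (x : ℝ) : ∫ y, ρ (x - y) = 1 := by
  rw [integral_sub_left_eq_self (fun y => ρ y), hρ.integral]

lemma integrable_comp_sub (hρ : IsMollifier ρ ε) (x : ℝ) : Integrable fun y => ρ (x - y) :=
  (hρ.smooth.continuous.integrable_of_hasCompactSupport hρ.compact).comp_sub_left x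

lemma lintegral_comp_sub (hρ : IsMollifier ρ ε) (x : ℝ) :
    ∫⁻ y, ENNReal.ofReal (ρ (x - y)) = 1 := by
  rw [← ofReal_integral_eq_lintegral_ofReal (hρ.integrable_comp_sub x)
    (Eventually.of_forall fun y => hρ.nonneg _), hρ.integral_comp_sub, ENNReal.ofReal_one]

/-- A mollification is an average with weights of total mass one, so it stays within `δ` of `c` when
the averaged values do. -/
lemma abs_mol_sub_le (hρ : IsMollifier ρ ε) {f : ℝ → ℝ} (hf : LocallyIntegrable f) {x c δ : ℝ}
    (h : ∀ y, |x - y| ≤ ε → |f y - c| ≤ δ) : |mol ρ f x - c| ≤ δ := by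
  have e : mol ρ f x - c = ∫ y, (f y - c) * ρ (x - y) := by
    simp only [sub_mul]
    rw [integral_sub (integrable_mul_kernel hf hρ.smooth.continuous hρ.compact x)
      ((hρ.integrable_comp_sub x).const_mul c), integral_const_mul, hρ.integral_comp_sub, mul_one,
      mol]
  rw [e, ← Real.norm_eq_abs]
  refine (norm_integral_le_of_norm_le (g := fun y => δ * ρ (x - y))
    ((hρ.integrable_comp_sub x).const_mul δ) (Eventually.of_forall fun y => ?_)).trans ?_
  · rw [Real.norm_eq_abs, abs_mul, abs_of_nonneg (hρ.nonneg _)]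
    by_cases hy : |x - y| ≤ ε
    · exact mul_le_mul_of_nonneg_right (h y hy) (hρ.nonneg _)
    · rw [hρ.support _ (not_le.1 hy)]
      simp
  · rw [integral_const_mul, hρ.integral_comp_sub, mul_one]

lemma abs_mol_sub_self_le (hρ : IsMollifier ρ ε) {f : ℝ → ℝ} {B : ℝ} (hB : 0 ≤ B)
    (h : ∀ x y, (f x - f y) ^ 2 ≤ B * |x - y|) (x : ℝ) : |mol ρ f x - f x| ≤ √(B * ε) := by
  refine hρ.abs_mol_sub_le (continuous_of_holder h).locallyIntegrable fun y hy => ?_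
  rw [← Real.sqrt_sq_eq_abs]
  refine Real.sqrt_le_sqrt ((h y x).trans ?_)
  rw [abs_sub_comm]
  gcongr

/-- Jensen's inequality for the square, from Cauchy–Schwarz with the kernel split as `√ρ * √ρ`. -/
lemma enorm_mol_sq_le_lintegral (hρ : IsMollifier ρ ε) {f : ℝ → ℝ} (hf : LocallyIntegrable f)
    (x : ℝ) : ‖mol ρ f x‖ₑ ^ 2 ≤ ∫⁻ y, ‖f y‖ₑ ^ 2 * ENNReal.ofReal (ρ (x - y)) := by
  have hc := hρ.smooth.continuous
  have e : mol ρ f x = ∫ y, (f y * √(ρ (x - y))) * √(ρ (x - y)) := by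
    simp only [mul_assoc, Real.mul_self_sqrt (hρ.nonneg _)]
    rfl
  rw [e]
  refine (enorm_integral_mul_sq_le volume
    (hf.aestronglyMeasurable.fun_mul (by fun_prop)) (by fun_prop)).trans ?_
  simp only [enorm_mul, mul_pow, enorm_sq_eq_ofReal (√_), Real.sq_sqrt (hρ.nonneg _)]
  rw [hρ.lintegral_comp_sub, mul_one]

/-- Jensen's inequality, then Tonelli; the support of the kernel allows the weight at `x` to be
traded for `K` times the weight at `y`. -/
lemma lintegral_weight_mol_sq_le (hρ : IsMollifier ρ ε) {f : ℝ → ℝ} (hf : LocallyIntegrable f)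
    {w : ℝ → ℝ≥0∞} (hw : Measurable w) {K : ℝ≥0∞} (hK : ∀ x y, |x - y| ≤ ε → w x ≤ K * w y) :
    ∫⁻ x, w x * ‖mol ρ f x‖ₑ ^ 2 ≤ K * ∫⁻ x, w x * ‖f x‖ₑ ^ 2 := by
  have hc : Measurable ρ := hρ.smooth.continuous.measurable
  have hfm : AEMeasurable (fun y => ‖f y‖ₑ ^ 2) := hf.aestronglyMeasurable.enorm.pow_const 2
  calc ∫⁻ x, w x * ‖mol ρ f x‖ₑ ^ 2
      ≤ ∫⁻ x, ∫⁻ y, w x * (‖f y‖ₑ ^ 2 * ENNReal.ofReal (ρ (x - y))) := by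
        refine lintegral_mono fun x => ?_
        rw [lintegral_const_mul'' _ (hfm.fun_mul (by fun_prop))]
        gcongr
        exact hρ.enorm_mol_sq_le_lintegral hf x
    _ = ∫⁻ y, ∫⁻ x, w x * (‖f y‖ₑ ^ 2 * ENNReal.ofReal (ρ (x - y))) := by
        refine lintegral_lintegral_swap ?_
        refine (hw.comp measurable_fst).aemeasurable.fun_mul (AEMeasurable.fun_mul ?_ ?_)
        · exact hfm.comp_quasiMeasurePreserving Measure.quasiMeasurePreserving_snd
        · exact (by fun_prop : Measurable fun p : ℝ × ℝ =>
            ENNReal.ofReal (ρ (p.1 - p.2))).aemeasurable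
    _ ≤ ∫⁻ y, (K * w y * ‖f y‖ₑ ^ 2) * ∫⁻ x, ENNReal.ofReal (ρ (x - y)) := by
        refine lintegral_mono fun y => ?_
        rw [← lintegral_const_mul _ (by fun_prop)]
        refine lintegral_mono fun x => ?_
        rw [mul_assoc (K * w y), mul_left_comm, mul_left_comm (K * w y)]
        by_cases hxy : |x - y| ≤ ε
        · gcongr
          exact hK x y hxy
        · simp [hρ.support _ (not_le.1 hxy)]
    _ = K * ∫⁻ x, w x * ‖f x‖ₑ ^ 2 := by
        rw [← lintegral_const_mul'' _ (hw.aemeasurable.fun_mul hfm)]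
        refine lintegral_congr fun y => ?_
        rw [lintegral_sub_right_eq_self (fun x => ENNReal.ofReal (ρ x)) y]
        have := hρ.lintegral_comp_sub 0
        rw [lintegral_sub_left_eq_self (fun x => ENNReal.ofReal (ρ x)) 0] at this
        rw [this, mul_one, mul_assoc]

end IsMollifier

end MollifierEstimates

/-! ### The potential near its wells -/

section Potential

variable {U : ℝ → ℝ} {a m k : ℝ}

lemma ConditionU1.eq_zero_right (hU : ConditionU1 U a m k) (hk : 1 < k) : U a = 0 := by
  obtain ⟨C, hC⟩ := hU.right_well.bound
  have := hC.self_of_nhds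
  simp only [sub_self, abs_zero, Real.zero_rpow (by linarith : 2 * k ≠ 0)] at this
  simpa using this

lemma ConditionU1.eq_zero_left (hU : ConditionU1 U a m k) (hk : 1 < k) : U (-a) = 0 := by
  rw [hU.even, hU.eq_zero_right hk]

lemma ConditionU1.nonneg (hU : ConditionU1 U a m k) (hk : 1 < k) (y : ℝ) : 0 ≤ U y := by
  by_cases h1 : y = a
  · rw [h1, hU.eq_zero_right hk]
  by_cases h2 : y = -a
  · rw [h2, hU.eq_zero_left hk]
  exact (hU.pos y h1 h2).le

/-- Because `2 * k > 2`, the remainder is `o((y - a)²)`, so it is at most half of the leading term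
near `a`. -/
lemma ConditionU1.near_well (hU : ConditionU1 U a m k) (hk : 1 < k) :
    ∃ δ > 0, ∀ y, |y - a| < δ → m ^ 2 / 4 * (y - a) ^ 2 ≤ U y ∧ U y ≤ m ^ 2 * (y - a) ^ 2 := by
  have hm := hU.m_pos
  have h1 : (fun y : ℝ => |y - a| ^ (2 * k)) =o[𝓝 a] fun y => (y - a) ^ 2 := by
    have h2 : Tendsto (fun y : ℝ => |y - a| ^ (2 * k - 2)) (𝓝 a) (𝓝 0) := by
      have h3 : Continuous fun y : ℝ => |y - a| ^ (2 * k - 2) :=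
        (by fun_prop : Continuous fun y : ℝ => |y - a|).rpow_const fun _ => Or.inr (by linarith)
      have := h3.tendsto a
      rwa [sub_self, abs_zero, Real.zero_rpow (by linarith)] at this
    have h3 : (fun y : ℝ => |y - a| ^ (2 * k)) = fun y => |y - a| ^ (2 * k - 2) * (y - a) ^ 2 := by
      ext y
      rw [← sq_abs (y - a)]
      by_cases h0 : |y - a| = 0
      · rw [h0, Real.zero_rpow (by linarith)]
        simp
      · rw [← Real.rpow_natCast, ← Real.rpow_add (lt_of_le_of_ne (abs_nonneg _) (Ne.symm h0))]
        norm_num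
    rw [h3]
    simpa using ((isLittleO_one_iff ℝ).2 h2).mul_isBigO (isBigO_refl (fun y => (y - a) ^ 2) (𝓝 a))
  have h2 := (hU.right_well.trans_isLittleO h1).bound (c := m ^ 2 / 4) (by positivity)
  obtain ⟨δ, hδ, h⟩ := Metric.eventually_nhds_iff.1 h2
  refine ⟨δ, hδ, fun y hy => ?_⟩
  have h3 := h (y := y) (by rwa [Real.dist_eq])
  rw [Real.norm_eq_abs, Real.norm_eq_abs, abs_of_nonneg (sq_nonneg (y - a)), abs_le] at h3
  have h4 : 0 ≤ m ^ 2 * (y - a) ^ 2 := by positivity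
  constructor <;> linarith [h3.1, h3.2]

/-- Near `a` this is the quadratic behaviour; elsewhere `(y - a)²` is bounded below and `U` is
bounded on the compact interval. -/
lemma ConditionU1.le_right_well (hU : ConditionU1 U a m k) (hk : 1 < k) (M : ℝ) :
    ∃ C, 0 ≤ C ∧ ∀ y, |y| ≤ M → U y ≤ C * (y - a) ^ 2 := by
  obtain ⟨δ, hδ, h⟩ := hU.near_well hk
  obtain ⟨B, hB⟩ := (isCompact_Icc (a := -M) (b := M)).exists_bound_of_continuousOn
    hU.smooth.continuous.continuousOn
  refine ⟨m ^ 2 + |B| / δ ^ 2, by positivity, fun y hy => ?_⟩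
  by_cases hya : |y - a| < δ
  · have h2 : 0 ≤ |B| / δ ^ 2 * (y - a) ^ 2 := by positivity
    nlinarith [(h y hya).2]
  · have h1 : U y ≤ |B| := (le_abs_self _).trans ((hB y (abs_le.1 hy)).trans (le_abs_self _))
    have h2 : δ ^ 2 ≤ (y - a) ^ 2 := by
      rw [← sq_abs (y - a)]
      exact pow_le_pow_left₀ hδ.le (not_lt.1 hya) 2
    have h3 : |B| ≤ |B| / δ ^ 2 * (y - a) ^ 2 := by
      rw [div_mul_eq_mul_div, le_div_iff₀ (by positivity)]
      gcongr
    have : 0 ≤ m ^ 2 * (y - a) ^ 2 := by positivity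
    linarith

lemma ConditionU1.le_left_well (hU : ConditionU1 U a m k) {M C : ℝ}
    (hC : ∀ y, |y| ≤ M → U y ≤ C * (y - a) ^ 2) (y : ℝ) (hy : |y| ≤ M) :
    U y ≤ C * (y + a) ^ 2 := by
  rw [← hU.even]
  refine (hC (-y) (by rwa [abs_neg])).trans_eq ?_
  ring

lemma ConditionU1.hasDerivAt (hU : ConditionU1 U a m k) (y : ℝ) :
    HasDerivAt U (-force U y) y := by
  rw [force, neg_neg]
  exact (hU.smooth.differentiable (by simp) y).hasDerivAt

lemma ConditionU1.contDiff_force (hU : ConditionU1 U a m k) : ContDiff ℝ ∞ (force U) := by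
  have : ContDiff ℝ ∞ (deriv U) := by
    have := hU.smooth
    rw [contDiff_infty_iff_deriv] at this
    exact this.2
  exact this.neg

lemma exists_lipschitz_on_Icc {f : ℝ → ℝ} (hf : ContDiff ℝ ∞ f) (M : ℝ) :
    ∃ L, 0 ≤ L ∧ ∀ x y, |x| ≤ M → |y| ≤ M → |f x - f y| ≤ L * |x - y| := by
  obtain ⟨B, hB⟩ := (isCompact_Icc (a := -M) (b := M)).exists_bound_of_continuousOn
    (hf.continuous_deriv (by simp)).continuousOn
  refine ⟨|B|, abs_nonneg _, fun x y hx hy => ?_⟩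
  exact (convex_Icc (-M) M).norm_image_sub_le_of_norm_deriv_le
    (fun z _ => hf.differentiable (by simp) z) (fun z hz => (hB z hz).trans (le_abs_self _))
    (abs_le.1 hy) (abs_le.1 hx)

end Potential

/-! ### The kink: first integral and exponential decay -/

section Kink

variable {U : ℝ → ℝ} {a m k : ℝ} {s : ℝ → ℝ}

lemma IsKink.hasDerivAt (hs : IsKink U a s) (x : ℝ) : HasDerivAt s (deriv s x) x :=
  (hs.smooth.differentiable (by simp) x).hasDerivAt

lemma IsKink.continuous_deriv (hs : IsKink U a s) : Continuous (deriv s) :=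
  hs.smooth.continuous_deriv (by simp)

lemma IsKink.hasDerivAt_deriv (hs : IsKink U a s) (x : ℝ) :
    HasDerivAt (deriv s) (deriv U (s x)) x := by
  have h1 : ContDiff ℝ 1 (deriv s) := by
    have := hs.smooth
    rw [show (2 : WithTop ℕ∞) = 1 + 1 by norm_num, contDiff_succ_iff_deriv] at this
    exact this.2.2
  have := (h1.differentiable (by simp) x).hasDerivAt
  rwa [sub_eq_zero.1 (hs.stationary x)] at this

/-- The quantity `s'²/2 - U(s)` is conserved. As `U(s) → U(a) = 0`, the energy density tends to the
conserved value at `+∞`, and integrability forces that limit to vanish. -/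
lemma IsKink.deriv_sq (hU : ConditionU1 U a m k) (hk : 1 < k) (hs : IsKink U a s) (x : ℝ) :
    deriv s x ^ 2 = 2 * U (s x) := by
  have hd : ∀ x, HasDerivAt (fun x => deriv s x ^ 2 / 2 - U (s x)) 0 x := by
    intro x
    have h1 := ((hs.hasDerivAt_deriv x).pow 2).div_const 2
    have h2 := (hU.hasDerivAt (s x)).comp x (hs.hasDerivAt x)
    refine (h1.sub h2).congr_deriv ?_
    simp [force]
    ring
  obtain ⟨c, hc⟩ : ∃ c, ∀ x, deriv s x ^ 2 / 2 - U (s x) = c :=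
    ⟨_, fun x => is_const_of_deriv_eq_zero (fun x => (hd x).differentiableAt)
      (fun x => (hd x).deriv) x 0⟩
  have hlim : Tendsto (fun x => deriv s x ^ 2 / 2 + U (s x)) atTop (𝓝 c) := by
    have h1 := (hU.smooth.continuous.tendsto a).comp hs.tendsto_atTop
    rw [hU.eq_zero_right hk] at h1
    have h2 := (h1.const_mul 2).const_add c
    rw [mul_zero, add_zero] at h2
    refine h2.congr fun x => ?_
    simp only [Function.comp, ← hc x]
    ring
  have hc0 : c = 0 := by
    refine IntegrableAtFilter.eq_zero_of_tendsto (μ := volume)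
      (f := fun x => deriv s x ^ 2 / 2 + U (s x)) ?_ ?_ hlim
    · exact hs.finite_energy.integrableAtFilter _
    · intro t ht
      obtain ⟨b, hb⟩ := mem_atTop_sets.1 ht
      rw [← top_le_iff, ← Real.volume_Ici (a := b)]
      exact measure_mono hb
  have := hc x
  linarith

lemma IsKink.exists_abs_le (hs : IsKink U a s) : ∃ M, ∀ x, |s x| ≤ M := by
  obtain ⟨R, hR⟩ := eventually_atTop.1
    (hs.tendsto_atTop.eventually (Metric.ball_mem_nhds a one_pos))
  obtain ⟨B, hB⟩ := (isCompact_Icc (a := 0) (b := R)).exists_bound_of_continuousOn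
    hs.smooth.continuous.continuousOn
  have h0 : ∀ x, 0 ≤ x → |s x| ≤ |B| + (|a| + 1) := by
    intro x hx
    rcases le_total x R with h | h
    · have h1 : |s x| ≤ |B| := (hB x ⟨hx, h⟩).trans (le_abs_self B)
      have := abs_nonneg a
      linarith
    · have h1 : |s x - a| < 1 := hR x h
      have h2 : |s x| ≤ |s x - a| + |a| := by simpa using abs_add_le (s x - a) a
      have := abs_nonneg B
      linarith
  refine ⟨|B| + (|a| + 1), fun x => ?_⟩
  rcases le_total 0 x with h | h
  · exact h0 x h
  · rw [← abs_neg, ← hs.odd]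
    exact h0 (-x) (by linarith)

lemma exp_decay_of_deriv_le {q q' : ℝ → ℝ} {c X : ℝ} (hq : ∀ x, HasDerivAt q (q' x) x)
    (h : ∀ x, X ≤ x → q' x ≤ -c * q x) {x : ℝ} (hx : X ≤ x) :
    q x ≤ q X * Real.exp (c * X) * Real.exp (-c * x) := by
  have hd : ∀ x, HasDerivAt (fun x => q x * Real.exp (c * x))
      ((q' x + c * q x) * Real.exp (c * x)) x := by
    intro x
    have h1 : HasDerivAt (fun x => Real.exp (c * x)) (Real.exp (c * x) * c) x := by
      simpa using ((hasDerivAt_id x).const_mul c).exp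
    exact ((hq x).mul h1).congr_deriv (by ring)
  have hanti : AntitoneOn (fun x => q x * Real.exp (c * x)) (Set.Ici X) := by
    refine antitoneOn_of_deriv_nonpos (convex_Ici X) (fun x _ => (hd x).continuousAt.continuousWithinAt)
      (fun x _ => (hd x).differentiableAt.differentiableWithinAt) fun x hx => ?_
    rw [interior_Ici] at hx
    rw [(hd x).deriv]
    exact mul_nonpos_of_nonpos_of_nonneg (by linarith [h x (le_of_lt hx)]) (Real.exp_pos _).le
  have h1 : q x * Real.exp (c * x) ≤ q X * Real.exp (c * X) := hanti (Set.self_mem_Ici) hx hx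
  calc q x = q x * Real.exp (c * x) * Real.exp (-c * x) := by
        rw [mul_assoc, ← Real.exp_add]; simp
    _ ≤ _ := mul_le_mul_of_nonneg_right h1 (Real.exp_pos _).le

/-- Near the well, `s'²` is comparable with `(s - a)²`. Unless `s` reaches `a`, the product `(s - a)
s'` therefore never vanishes and keeps one sign; the sign is negative since `(s - a)² → 0`. The
lower bound for `s'²` then gives `q' ≤ -m q` for `q = (s - a)²`. -/
lemma IsKink.exists_exp_decay (hU : ConditionU1 U a m k) (hk : 1 < k) (hs : IsKink U a s) :
    ∃ A c X : ℝ, 0 < c ∧ ∀ x, X ≤ x → (s x - a) ^ 2 ≤ A * Real.exp (-c * x) := by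
  have hm := hU.m_pos
  obtain ⟨δ, hδ, hnear⟩ := hU.near_well hk
  obtain ⟨R, hR⟩ := eventually_atTop.1
    (hs.tendsto_atTop.eventually (Metric.ball_mem_nhds a hδ))
  have hR' : ∀ x, R ≤ x → m ^ 2 / 2 * (s x - a) ^ 2 ≤ deriv s x ^ 2 ∧
      deriv s x ^ 2 ≤ 2 * m ^ 2 * (s x - a) ^ 2 := by
    intro x hx
    have := hnear (s x) (hR x hx)
    rw [hs.deriv_sq hU hk]
    constructor <;> linarith [this.1, this.2]
  have hd : ∀ x, HasDerivAt (fun x => s x - a) (deriv s x) x := fun x =>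
    (hs.hasDerivAt x).sub_const a
  by_cases hz : ∃ X, R ≤ X ∧ s X - a = 0
  · obtain ⟨X, hX, hsX⟩ := hz
    refine ⟨0, 1, X, one_pos, fun x hx => ?_⟩
    -- If `s` reaches `a`, then `|s'| ≤ 2m|s - a|` keeps it there by Grönwall's inequality, and any
    -- decay rate will do.
    have := eq_zero_of_abs_deriv_le_mul_abs_self_of_eq_zero_right (f := fun x => s x - a)
      (f' := deriv s) (K := 2 * m) (a := X) (b := x)
      (fun y _ => (hd y).continuousAt.continuousWithinAt) (fun y _ => (hd y).hasDerivWithinAt) hsX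
      (fun y hy => by
        rw [Real.norm_eq_abs, Real.norm_eq_abs]
        refine abs_le_of_sq_le_sq' ?_ (by positivity) |> abs_le.2
        rw [mul_pow, sq_abs]
        nlinarith [(hR' y (hX.trans hy.1)).2, sq_nonneg (s y - a), sq_nonneg m,
          mul_nonneg (sq_nonneg m) (sq_nonneg (s y - a))]) x ⟨hx, le_rfl⟩
    rw [this]
    simp
  · push Not at hz
    have hq : ∀ x, HasDerivAt (fun x => (s x - a) ^ 2) (2 * ((s x - a) * deriv s x)) x := by
      intro x
      refine ((hd x).pow 2).congr_deriv ?_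
      simp
      ring
    have hp : ∀ x, R ≤ x → m ^ 2 / 2 * ((s x - a) ^ 2) ^ 2 ≤ ((s x - a) * deriv s x) ^ 2 := by
      intro x hx
      rw [mul_pow]
      nlinarith [(hR' x hx).1, sq_nonneg (s x - a)]
    have hne : ∀ x ∈ Set.Ici R, (s x - a) * deriv s x ≠ 0 := by
      intro x hx h0
      have h1 := hp x hx
      rw [h0] at h1
      have h2 : 0 < (s x - a) ^ 2 := by
        have := hz x hx
        positivity
      have : 0 < m ^ 2 / 2 * ((s x - a) ^ 2) ^ 2 := by positivity
      nlinarith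
    have hcont : ContinuousOn (fun x => (s x - a) * deriv s x) (Set.Ici R) := by
      have := hs.smooth.continuous
      have := hs.continuous_deriv
      fun_prop
    have hlim : Tendsto (fun x => (s x - a) ^ 2) atTop (𝓝 0) := by
      simpa using (hs.tendsto_atTop.sub_const a).pow 2
    -- A positive sign would make `(s - a)²` nondecreasing and nonzero, against its limit 0.
    have hneg : ∀ x ∈ Set.Ici R, (s x - a) * deriv s x < 0 := by
      by_contra! hcon
      obtain ⟨x₁, hx₁, h1⟩ := hcon
      have hpos : ∀ x ∈ Set.Ici R, 0 ≤ (s x - a) * deriv s x := by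
        intro x hx
        by_contra! hxneg
        obtain ⟨y, hy, hy0⟩ := isPreconnected_Ici.intermediate_value hx hx₁ hcont
          (⟨hxneg.le, h1⟩ : (0 : ℝ) ∈ Set.Icc _ _)
        exact hne y hy hy0
      have hmono : MonotoneOn (fun x => (s x - a) ^ 2) (Set.Ici R) := by
        refine monotoneOn_of_deriv_nonneg (convex_Ici R)
          (fun x _ => (hq x).continuousAt.continuousWithinAt)
          (fun x _ => (hq x).differentiableAt.differentiableWithinAt) fun x hx => ?_
        rw [interior_Ici] at hx
        rw [(hq x).deriv]
        have := hpos x (Set.mem_Ici.2 (le_of_lt hx))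
        linarith
      have h2 : (s R - a) ^ 2 ≤ 0 := by
        refine ge_of_tendsto hlim ?_
        filter_upwards [eventually_ge_atTop R] with x hx
        exact hmono Set.self_mem_Ici hx hx
      have h3 := hz R le_rfl
      have : 0 < (s R - a) ^ 2 := by positivity
      linarith
    refine ⟨_, m, R, hm, fun x hx => exp_decay_of_deriv_le hq (fun x hx => ?_) hx⟩
    have h1 := hneg x hx
    have h2 := hp x hx
    have h3 : m / 2 * (s x - a) ^ 2 ≤ -((s x - a) * deriv s x) := by
      refine abs_le_of_sq_le_sq' ?_ (by linarith) |>.2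
      rw [neg_sq, mul_pow]
      nlinarith [mul_nonneg (sq_nonneg m) (sq_nonneg ((s x - a) ^ 2))]
    linarith

lemma IsKink.integrable_weight (hU : ConditionU1 U a m k) (hk : 1 < k) (hs : IsKink U a s)
    (p : ℝ) : Integrable fun x => (1 + x ^ 2) ^ p * (s |x| - a) ^ 2 := by
  obtain ⟨A, c, X, hc, hdec⟩ := hs.exists_exp_decay hU hk
  have hcs := hs.smooth.continuous
  have hcont : Continuous fun x : ℝ => (1 + x ^ 2) ^ p * (s |x| - a) ^ 2 :=
    ((by fun_prop : Continuous fun x : ℝ => 1 + x ^ 2).rpow_const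
      fun x => Or.inl (by positivity)).mul (by fun_prop)
  have hO : (fun x : ℝ => (1 + x ^ 2) ^ p * (s |x| - a) ^ 2) =O[atTop]
      fun x => Real.exp (-(c / 2) * x) := by
    have h1 : (fun x : ℝ => (1 + x ^ 2) ^ p) =O[atTop] fun x => Real.exp (c / 2 * x) := by
      have h2 : (fun x : ℝ => (1 + x ^ 2) ^ p) =O[atTop] fun x => x ^ (2 * |p|) := by
        refine IsBigO.of_bound (2 ^ |p|) ?_
        filter_upwards [eventually_ge_atTop 1] with x hx
        have h3 : (0 : ℝ) < 1 + x ^ 2 := by positivity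
        have hx0 : 0 ≤ x := by linarith
        rw [Real.norm_of_nonneg (by positivity), Real.norm_of_nonneg (by positivity)]
        calc (1 + x ^ 2) ^ p ≤ (1 + x ^ 2) ^ |p| :=
              Real.rpow_le_rpow_of_exponent_le (by nlinarith) (le_abs_self p)
          _ ≤ (2 * x ^ 2) ^ |p| :=
              Real.rpow_le_rpow h3.le (by nlinarith) (abs_nonneg p)
          _ = 2 ^ |p| * x ^ (2 * |p|) := by
              rw [Real.mul_rpow (by norm_num) (by positivity), Real.rpow_mul hx0]
              norm_num
      exact h2.trans (isLittleO_rpow_exp_pos_mul_atTop _ (by positivity)).isBigO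
    have h2 : (fun x : ℝ => (s |x| - a) ^ 2) =O[atTop] fun x => Real.exp (-c * x) := by
      refine IsBigO.of_bound A ?_
      filter_upwards [eventually_ge_atTop X, eventually_ge_atTop 0] with x hx hx0
      rw [Real.norm_of_nonneg (by positivity), Real.norm_of_nonneg (by positivity),
        abs_of_nonneg hx0]
      exact hdec x hx
    refine (h1.mul h2).congr_right fun x => ?_
    rw [← Real.exp_add]
    congr 1
    ring
  have hpos : IntegrableOn (fun x : ℝ => (1 + x ^ 2) ^ p * (s |x| - a) ^ 2) (Set.Ioi 0) :=
    integrable_of_isBigO_exp_neg (by positivity) hcont.continuousOn hO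
  have hneg : IntegrableOn (fun x : ℝ => (1 + x ^ 2) ^ p * (s |x| - a) ^ 2) (Set.Iic 0) := by
    have := IntegrableOn.comp_neg_Iic (c := (0 : ℝ)) (μ := volume)
      (f := fun x : ℝ => (1 + x ^ 2) ^ p * (s |x| - a) ^ 2)
      (by rw [neg_zero, integrableOn_Ici_iff_integrableOn_Ioi]; exact hpos)
    simpa using this
  rw [← integrableOn_univ, ← Set.Iic_union_Ioi (a := (0 : ℝ))]
  exact hneg.union hpos

/-- The distance of the kink at `x` to the well `a` (for `x ≥ 0`) or `-a` (for `x ≤ 0`) is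
`|s |x| - a|`; so a bound of `U` near the wells controls `U (s + z)`. -/
lemma IsKink.potential_add_le (hU : ConditionU1 U a m k) (hs : IsKink U a s) {M C : ℝ}
    (hC0 : 0 ≤ C) (hC : ∀ y, |y| ≤ M → U y ≤ C * (y - a) ^ 2) (x z : ℝ) (hz : |s x + z| ≤ M) :
    U (s x + z) ≤ 2 * C * (z ^ 2 + (s |x| - a) ^ 2) := by
  rcases le_total 0 x with h | h
  · rw [abs_of_nonneg h]
    have h1 : (s x + z - a) ^ 2 ≤ 2 * (z ^ 2 + (s x - a) ^ 2) := by
      nlinarith [sq_nonneg (s x - a - z)]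
    nlinarith [hC _ hz]
  · rw [abs_of_nonpos h, hs.odd]
    have h1 : (s x + z + a) ^ 2 ≤ 2 * (z ^ 2 + (-s x - a) ^ 2) := by
      nlinarith [sq_nonneg (s x + a - z)]
    nlinarith [hU.le_left_well hC _ hz]

end Kink

/-! ### The weighted energy inequality -/

section EnergyIdentity

lemma hasDerivAt_intervalIntegral_of_continuous {G G' : ℝ → ℝ → ℝ}
    (hG : ∀ t, Continuous (G t)) (hG' : Continuous fun p : ℝ × ℝ => G' p.1 p.2)
    (hd : ∀ t x, HasDerivAt (fun τ => G τ x) (G' t x) t) (a b t : ℝ) :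
    HasDerivAt (fun τ => ∫ x in a..b, G τ x) (∫ x in a..b, G' t x) t := by
  obtain ⟨B, hB⟩ := ((isCompact_Icc (a := t - 1) (b := t + 1)).prod
    (isCompact_uIcc (a := a) (b := b))).exists_bound_of_continuousOn hG'.continuousOn
  refine (intervalIntegral.hasDerivAt_integral_of_dominated_loc_of_deriv_le (F' := G')
    (bound := fun _ => B) (Icc_mem_nhds (by linarith : t - 1 < t) (by linarith : t < t + 1))
    (Eventually.of_forall fun τ => (hG τ).aestronglyMeasurable) ((hG t).intervalIntegrable _ _)
    ?_ (Eventually.of_forall fun x hx τ hτ => ?_) intervalIntegrable_const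
    (Eventually.of_forall fun x _ τ _ => hd τ x)).2
  · exact (hG'.comp (by fun_prop : Continuous fun x : ℝ => (t, x))).aestronglyMeasurable
  · exact hB (τ, x) ⟨hτ, Set.uIoc_subset_uIcc hx⟩

/-- The energy density of the field `u` with time derivative `v` and space derivative `q`. -/
noncomputable def energyDensity (U : ℝ → ℝ) (u v q : ℝ) : ℝ := v ^ 2 / 2 + q ^ 2 / 2 + U u

/-- In the time derivative of `W * e`, the terms `v * qx + q * vx` are the space derivative of `v *
q`. Integrating by parts leaves `-Wx * v * q`, with `|v * q| ≤ e` because `U ≥ 0`, and the cone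
condition absorbs it into `Wt * e`. What remains is the defect `v * (f - F(u))`: here `f` is the
force actually present in the equation, later the mollified one. -/
lemma weighted_energy_le {U F : ℝ → ℝ} (hU0 : ∀ y, 0 ≤ U y) (hU : ∀ y, HasDerivAt U (-F y) y)
    (hF : Continuous F) {u v q vx qx f W Wt Wx : ℝ → ℝ → ℝ}
    (hu : ∀ t x, HasDerivAt (fun τ => u τ x) (v t x) t)
    (hv : ∀ t x, HasDerivAt (fun τ => v τ x) (qx t x + f t x) t)
    (hq : ∀ t x, HasDerivAt (fun τ => q τ x) (vx t x) t)
    (hvx : ∀ t x, HasDerivAt (v t) (vx t x) x)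
    (hqx : ∀ t x, HasDerivAt (q t) (qx t x) x)
    (cu : Continuous fun p : ℝ × ℝ => u p.1 p.2) (cv : Continuous fun p : ℝ × ℝ => v p.1 p.2)
    (cq : Continuous fun p : ℝ × ℝ => q p.1 p.2) (cvx : Continuous fun p : ℝ × ℝ => vx p.1 p.2)
    (cqx : Continuous fun p : ℝ × ℝ => qx p.1 p.2) (cf : Continuous fun p : ℝ × ℝ => f p.1 p.2)
    (hWt : ∀ t x, HasDerivAt (fun τ => W τ x) (Wt t x) t)
    (hWx : ∀ t x, HasDerivAt (W t) (Wx t x) x)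
    (cW : Continuous fun p : ℝ × ℝ => W p.1 p.2) (cWt : Continuous fun p : ℝ × ℝ => Wt p.1 p.2)
    (cWx : Continuous fun p : ℝ × ℝ => Wx p.1 p.2)
    {T N K : ℝ} (hT : 0 ≤ T) (hN : 0 ≤ N)
    (hW0 : ∀ t ∈ Set.Icc 0 T, ∀ x, 0 ≤ W t x)
    (hWN : ∀ t ∈ Set.Icc 0 T, W t N = 0 ∧ W t (-N) = 0)
    (hcone : ∀ t ∈ Set.Icc 0 T, ∀ x, Wt t x + |Wx t x| ≤ 0)
    (hK : ∀ t ∈ Set.Icc 0 T, ∫ x in (-N)..N, W t x * (|v t x| * |f t x - F (u t x)|) ≤ K) :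
    ∫ x in (-N)..N, W T x * energyDensity U (u T x) (v T x) (q T x) ≤
      (∫ x in (-N)..N, W 0 x * energyDensity U (u 0 x) (v 0 x) (q 0 x)) + K * T := by
  have cU : Continuous U := continuous_iff_continuousAt.2 fun y => (hU y).continuousAt
  have slice : ∀ {g : ℝ → ℝ → ℝ}, (Continuous fun p : ℝ × ℝ => g p.1 p.2) → ∀ t,
      Continuous (g t) := fun hg t =>
    hg.comp (by fun_prop : Continuous fun x : ℝ => (t, x))
  set e : ℝ → ℝ → ℝ := fun t x => energyDensity U (u t x) (v t x) (q t x) with he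
  set D : ℝ → ℝ → ℝ := fun t x => Wt t x * e t x + W t x *
    (v t x * (qx t x + f t x) + q t x * vx t x - F (u t x) * v t x) with hD
  have ce : Continuous fun p : ℝ × ℝ => e p.1 p.2 := by
    simp only [he, energyDensity]
    fun_prop
  have cD : Continuous fun p : ℝ × ℝ => D p.1 p.2 := by
    simp only [hD]
    fun_prop
  have hd : ∀ t x, HasDerivAt (fun τ => W τ x * e τ x) (D t x) t := by
    intro t x
    have h1 := ((((hv t x).pow 2).div_const 2).add (((hq t x).pow 2).div_const 2)).add
      ((hU (u t x)).comp t (hu t x))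
    refine ((hWt t x).mul h1).congr_deriv ?_
    simp only [hD, he, energyDensity, Pi.add_apply, Function.comp]
    simp
    left
    ring
  have hI := hasDerivAt_intervalIntegral_of_continuous
    (fun t => slice (g := fun t x => W t x * e t x) (cW.mul ce) t) cD hd (-N) N
  have hDle : ∀ t ∈ Set.Icc 0 T, ∫ x in (-N)..N, D t x ≤ K := by
    intro t ht
    have hprod : ∀ x, HasDerivAt (fun x => W t x * v t x * q t x)
        ((Wx t x * v t x + W t x * vx t x) * q t x + W t x * v t x * qx t x) x := fun x =>
      ((hWx t x).mul (hvx t x)).mul (hqx t x)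
    have s1 := slice cW t
    have s2 := slice cv t
    have s3 := slice cq t
    have s4 := slice cvx t
    have s5 := slice cqx t
    have s6 := slice cWx t
    have s7 := slice cf t
    have s8 := slice cu t
    -- The boundary terms vanish since the weight does at `±N`; subtracting this zero integral
    -- performs the integration by parts.
    have h0 : ∫ x in (-N)..N,
        ((Wx t x * v t x + W t x * vx t x) * q t x + W t x * v t x * qx t x) = 0 := by
      rw [intervalIntegral.integral_eq_sub_of_hasDerivAt (fun x _ => hprod x)
        ((by fun_prop : Continuous _).intervalIntegrable _ _), (hWN t ht).1, (hWN t ht).2]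
      simp
    refine le_trans ?_ (hK t ht)
    rw [← sub_zero (∫ x in (-N)..N, D t x), ← h0,
      ← intervalIntegral.integral_sub ((slice cD t).intervalIntegrable _ _)
        ((by fun_prop : Continuous _).intervalIntegrable _ _)]
    refine intervalIntegral.integral_mono_on (by linarith)
      (((slice cD t).sub (by fun_prop)).intervalIntegrable _ _)
      ((by fun_prop : Continuous _).intervalIntegrable _ _) fun x _ => ?_
    have hW := hW0 t ht x
    have hc := hcone t ht x
    have h1 : v t x * (f t x - F (u t x)) ≤ |v t x| * |f t x - F (u t x)| := by
      rw [← abs_mul]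
      exact le_abs_self _
    have h2 := mul_le_mul_of_nonneg_left h1 hW
    have h3 : -(Wx t x * (v t x * q t x)) ≤ |Wx t x| * e t x := by
      have h4 : |v t x * q t x| ≤ e t x := by
        have := hU0 (u t x)
        simp only [he, energyDensity, abs_le]
        constructor <;> nlinarith [sq_nonneg (v t x + q t x), sq_nonneg (v t x - q t x)]
      calc -(Wx t x * (v t x * q t x)) ≤ |Wx t x * (v t x * q t x)| := neg_le_abs _
        _ = |Wx t x| * |v t x * q t x| := abs_mul _ _
        _ ≤ _ := by gcongr
    have h5 : 0 ≤ e t x := by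
      have := hU0 (u t x)
      simp only [he, energyDensity]
      positivity
    have h6 : (Wt t x + |Wx t x|) * e t x ≤ 0 := mul_nonpos_of_nonpos_of_nonneg hc h5
    simp only [hD]
    nlinarith
  have hanti : AntitoneOn (fun t => (∫ x in (-N)..N, W t x * e t x) - K * t) (Set.Icc 0 T) := by
    have hd' : ∀ t, HasDerivAt (fun t => (∫ x in (-N)..N, W t x * e t x) - K * t)
        ((∫ x in (-N)..N, D t x) - K) t := fun t =>
      ((hI t).sub ((hasDerivAt_id t).const_mul K)).congr_deriv (by simp)
    refine antitoneOn_of_deriv_nonpos (convex_Icc 0 T)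
      (fun t _ => (hd' t).continuousAt.continuousWithinAt)
      (fun t _ => (hd' t).differentiableAt.differentiableWithinAt) fun t ht => ?_
    rw [(hd' t).deriv]
    linarith [hDle t (interior_subset ht)]
  have := hanti (Set.left_mem_Icc.2 hT) (Set.right_mem_Icc.2 hT) hT
  simp only [mul_zero, sub_zero] at this
  linarith

end EnergyIdentity

/-! ### A smooth weight decreasing along characteristics -/

section ConeWeight

/-- The bracket `(1 + x²)^(1/2)`. -/
noncomputable def bracket (x : ℝ) : ℝ := √(1 + x ^ 2)

lemma continuous_bracket : Continuous bracket := by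
  unfold bracket
  fun_prop

lemma bracket_sq (x : ℝ) : bracket x ^ 2 = 1 + x ^ 2 := Real.sq_sqrt (by positivity)

lemma one_le_bracket (x : ℝ) : 1 ≤ bracket x :=
  Real.one_le_sqrt.2 (by nlinarith [sq_nonneg x])

lemma bracket_pos (x : ℝ) : 0 < bracket x := one_pos.trans_le (one_le_bracket x)

lemma abs_le_bracket (x : ℝ) : |x| ≤ bracket x := Real.abs_le_sqrt (by linarith)

lemma bracket_le_one_add_abs (x : ℝ) : bracket x ≤ 1 + |x| := by
  refine (Real.sqrt_le_left (by positivity)).2 ?_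
  nlinarith [sq_abs x, abs_nonneg x]

lemma hasDerivAt_bracket (x : ℝ) : HasDerivAt bracket (x / bracket x) x := by
  have h1 : HasDerivAt (fun x : ℝ => 1 + x ^ 2) (2 * x) x := by
    simpa using (hasDerivAt_pow 2 x).const_add 1
  refine (h1.sqrt (by positivity)).congr_deriv ?_
  rw [bracket]
  field_simp

lemma abs_div_bracket_le (x : ℝ) : |x / bracket x| ≤ 1 := by
  rw [abs_div, abs_of_pos (bracket_pos x), div_le_one (bracket_pos x)]
  exact abs_le_bracket x

lemma bracket_le_bracket_add (x y : ℝ) : bracket x ≤ bracket y + |x - y| := by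
  have hy := abs_le_bracket y
  have hp := bracket_pos y
  refine (Real.sqrt_le_left (by positivity)).2 ?_
  have h1 := bracket_sq y
  have h2 : y * (x - y) ≤ bracket y * |x - y| := by
    calc y * (x - y) ≤ |y * (x - y)| := le_abs_self _
      _ = |y| * |x - y| := abs_mul _ _
      _ ≤ _ := by gcongr
  nlinarith [sq_abs (x - y)]

lemma bracket_rpow (x P : ℝ) : bracket x ^ P = (1 + x ^ 2) ^ (P / 2) := by
  rw [bracket, Real.sqrt_eq_rpow, ← Real.rpow_mul (by positivity)]
  congr 1
  ring

open Real (smoothTransition)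

/-- A weight of power growth `P`, cut off at distance `N`, which decreases along all the
characteristics and all slower lines on the time interval `[0, T]`. -/
noncomputable def coneWeight (P T N t x : ℝ) : ℝ :=
  (bracket x + (T - t)) ^ P * smoothTransition (N - bracket x - t)

/-- The time derivative of `coneWeight`. -/
noncomputable def coneWeightT (P T N t x : ℝ) : ℝ :=
  -(P * (bracket x + (T - t)) ^ (P - 1) * smoothTransition (N - bracket x - t) +
    (bracket x + (T - t)) ^ P * deriv smoothTransition (N - bracket x - t))

/-- The space derivative of `coneWeight`. -/
noncomputable def coneWeightX (P T N t x : ℝ) : ℝ :=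
  x / bracket x * (P * (bracket x + (T - t)) ^ (P - 1) * smoothTransition (N - bracket x - t) -
    (bracket x + (T - t)) ^ P * deriv smoothTransition (N - bracket x - t))

lemma hasDerivAt_smoothTransition (z : ℝ) :
    HasDerivAt smoothTransition (deriv smoothTransition z) z :=
  ((Real.smoothTransition.contDiff (n := 1)).differentiable (by simp) z).hasDerivAt

lemma continuous_deriv_smoothTransition : Continuous (deriv smoothTransition) :=
  (Real.smoothTransition.contDiff (n := 1)).continuous_deriv (by simp)

variable {P : ℝ}

/-- The condition `1 ≤ P` gives differentiability even for `t > T`, where the base of the power may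
vanish or be negative. -/
lemma hasDerivAt_coneWeight_time (hP : 1 ≤ P) (T N t x : ℝ) :
    HasDerivAt (fun τ => coneWeight P T N τ x) (coneWeightT P T N t x) t := by
  have h1 : HasDerivAt (fun τ => bracket x + (T - τ)) (-1) t :=
    ((hasDerivAt_id t).const_sub T).const_add _
  have h2 : HasDerivAt (fun τ => N - bracket x - τ) (-1) t := (hasDerivAt_id t).const_sub _
  refine ((h1.rpow_const (p := P) (Or.inr hP)).mul
    ((hasDerivAt_smoothTransition _).comp t h2)).congr_deriv ?_
  simp only [coneWeightT, Function.comp]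
  ring

lemma hasDerivAt_coneWeight_space (hP : 1 ≤ P) (T N t x : ℝ) :
    HasDerivAt (coneWeight P T N t) (coneWeightX P T N t x) x := by
  have h1 : HasDerivAt (fun x => bracket x + (T - t)) (x / bracket x) x :=
    (hasDerivAt_bracket x).add_const _
  have h2 : HasDerivAt (fun x => N - bracket x - t) (-(x / bracket x)) x :=
    ((hasDerivAt_bracket x).const_sub N).sub_const t
  refine ((h1.rpow_const (p := P) (Or.inr hP)).mul
    ((hasDerivAt_smoothTransition _).comp x h2)).congr_deriv ?_
  simp only [coneWeightX, Function.comp]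
  ring

lemma continuous_coneBase (T P : ℝ) (hP : 0 ≤ P) :
    Continuous fun p : ℝ × ℝ => (bracket p.2 + (T - p.1)) ^ P := by
  have := continuous_bracket
  exact (by fun_prop : Continuous fun p : ℝ × ℝ => bracket p.2 + (T - p.1)).rpow_const
    fun _ => Or.inr hP

lemma continuous_coneWeight (hP : 1 ≤ P) (T N : ℝ) :
    Continuous fun p : ℝ × ℝ => coneWeight P T N p.1 p.2 := by
  have := continuous_bracket
  have h1 := continuous_coneBase T P (by linarith)
  have h3 := Real.smoothTransition.continuous
  simp only [coneWeight]
  fun_prop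

lemma continuous_coneWeightT (hP : 1 ≤ P) (T N : ℝ) :
    Continuous fun p : ℝ × ℝ => coneWeightT P T N p.1 p.2 := by
  have := continuous_bracket
  have h1 := continuous_coneBase T P (by linarith)
  have h2 := continuous_coneBase T (P - 1) (by linarith)
  have h3 := Real.smoothTransition.continuous
  have h4 := continuous_deriv_smoothTransition
  simp only [coneWeightT]
  fun_prop

lemma continuous_coneWeightX (hP : 1 ≤ P) (T N : ℝ) :
    Continuous fun p : ℝ × ℝ => coneWeightX P T N p.1 p.2 := by
  have := continuous_bracket
  have h1 := continuous_coneBase T P (by linarith)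
  have h2 := continuous_coneBase T (P - 1) (by linarith)
  have h3 := Real.smoothTransition.continuous
  have h4 := continuous_deriv_smoothTransition
  have h5 : Continuous fun p : ℝ × ℝ => p.2 / bracket p.2 :=
    continuous_snd.div (by fun_prop) fun p => (bracket_pos _).ne'
  simp only [coneWeightX]
  fun_prop

lemma coneWeight_nonneg {T t : ℝ} (ht : t ≤ T) (N x : ℝ) : 0 ≤ coneWeight P T N t x :=
  mul_nonneg (Real.rpow_nonneg (by linarith [bracket_pos x]) _) (Real.smoothTransition.nonneg _)

lemma coneWeight_eq_zero {T N t x : ℝ} (ht : 0 ≤ t) (hx : N ≤ |x|) :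
    coneWeight P T N t x = 0 := by
  rw [coneWeight, Real.smoothTransition.zero_of_nonpos, mul_zero]
  linarith [abs_le_bracket x]

/-- Write `A` and `B` for the contributions of the power and of the cutoff, both nonnegative. The
time derivative is `-(A + B)`, while the space derivative is `A - B` times the slope of `bracket`,
which is at most 1 in modulus. -/
lemma coneWeightT_add_abs_le (hP : 1 ≤ P) {T t : ℝ} (ht : t ≤ T) (N x : ℝ) :
    coneWeightT P T N t x + |coneWeightX P T N t x| ≤ 0 := by
  have hb : 0 ≤ bracket x + (T - t) := by linarith [bracket_pos x]
  set A := P * (bracket x + (T - t)) ^ (P - 1) * smoothTransition (N - bracket x - t) with hA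
  set B := (bracket x + (T - t)) ^ P * deriv smoothTransition (N - bracket x - t) with hB
  have hA0 : 0 ≤ A := mul_nonneg (mul_nonneg (by linarith) (Real.rpow_nonneg hb _))
    (Real.smoothTransition.nonneg _)
  have hB0 : 0 ≤ B := mul_nonneg (Real.rpow_nonneg hb _)
    Real.smoothTransition.monotone.deriv_nonneg
  have h1 : |coneWeightX P T N t x| ≤ A + B := by
    rw [coneWeightX, ← hA, ← hB, abs_mul]
    calc |x / bracket x| * |A - B| ≤ 1 * |A - B| := by
          gcongr
          exact abs_div_bracket_le x
      _ ≤ A + B := by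
          rw [one_mul, abs_le]
          constructor <;> linarith
  rw [coneWeightT, ← hA, ← hB]
  linarith

lemma coneWeight_le {T t : ℝ} (hP : 0 ≤ P) (ht : 0 ≤ t) (htT : t ≤ T) (N x : ℝ) :
    coneWeight P T N t x ≤ (1 + T) ^ P * bracket x ^ P := by
  have hb := one_le_bracket x
  rw [← Real.mul_rpow (by linarith) (by linarith)]
  calc coneWeight P T N t x ≤ (bracket x + (T - t)) ^ P * 1 :=
        mul_le_mul_of_nonneg_left (Real.smoothTransition.le_one _)
          (Real.rpow_nonneg (by linarith) _)
    _ ≤ _ := by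
        rw [mul_one]
        refine Real.rpow_le_rpow (by linarith) ?_ hP
        nlinarith

end ConeWeight

/-! ### Passing between interval and Lebesgue integrals -/

section IntervalIntegrals

lemma intervalIntegral_le_of_lintegral_le {g : ℝ → ℝ} (hg : Continuous g) (h0 : ∀ x, 0 ≤ g x)
    {A : ℝ} (hA : 0 ≤ A) (h : ∫⁻ x, ENNReal.ofReal (g x) ≤ ENNReal.ofReal A) {a b : ℝ}
    (hab : a ≤ b) : ∫ x in a..b, g x ≤ A := by
  rw [intervalIntegral.integral_of_le hab, ← ENNReal.ofReal_le_ofReal_iff hA,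
    ofReal_integral_eq_lintegral_ofReal (hg.integrableOn_Ioc) (Eventually.of_forall h0)]
  exact (setLIntegral_le_lintegral _ _).trans h

lemma lintegral_le_of_intervalIntegral_le {g : ℝ → ℝ} (hg : Continuous g) (h0 : ∀ x, 0 ≤ g x)
    {A N : ℝ} (hN : 0 ≤ N) (hsupp : ∀ x, N ≤ |x| → g x = 0) (h : ∫ x in (-N)..N, g x ≤ A) :
    ∫⁻ x, ENNReal.ofReal (g x) ≤ ENNReal.ofReal A := by
  have e : ∫⁻ x, ENNReal.ofReal (g x) = ∫⁻ x in Set.Ioc (-N) N, ENNReal.ofReal (g x) := by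
    rw [setLIntegral_eq_of_support_subset]
    intro x hx
    have h1 : ¬ N ≤ |x| := fun hcon => hx (by simp [hsupp x hcon])
    rw [not_le, abs_lt] at h1
    exact ⟨h1.1, h1.2.le⟩
  rw [e, ← ofReal_integral_eq_lintegral_ofReal (hg.integrableOn_Ioc) (Eventually.of_forall h0),
    ← intervalIntegral.integral_of_le (by linarith)]
  exact ENNReal.ofReal_le_ofReal h

/-- Cauchy–Schwarz in time, obtained by expanding the nonnegative integral of `(T * g - J)²`. -/
lemma sq_intervalIntegral_le {g : ℝ → ℝ} (hg : Continuous g) {T : ℝ} (hT : 0 ≤ T) :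
    (∫ t in (0 : ℝ)..T, g t) ^ 2 ≤ T * ∫ t in (0 : ℝ)..T, g t ^ 2 := by
  rcases hT.eq_or_lt with h | h
  · simp [← h]
  set J := ∫ t in (0 : ℝ)..T, g t
  have h1 : 0 ≤ ∫ t in (0 : ℝ)..T, (T * g t - J) ^ 2 :=
    intervalIntegral.integral_nonneg hT fun t _ => sq_nonneg _
  have h2 : ∫ t in (0 : ℝ)..T, (T * g t - J) ^ 2
      = T ^ 2 * (∫ t in (0 : ℝ)..T, g t ^ 2) - 2 * T * J * J + T * J ^ 2 := by
    have : ∀ t, (T * g t - J) ^ 2 = T ^ 2 * g t ^ 2 - 2 * T * J * g t + J ^ 2 := fun t => by ring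
    simp only [this]
    rw [intervalIntegral.integral_add ((by fun_prop : Continuous _).intervalIntegrable _ _)
      intervalIntegrable_const,
      intervalIntegral.integral_sub ((by fun_prop : Continuous _).intervalIntegrable _ _)
      ((by fun_prop : Continuous _).intervalIntegrable _ _),
      intervalIntegral.integral_const_mul, intervalIntegral.integral_const_mul]
    simp [J]
  rw [h2] at h1
  have h3 : 0 ≤ T * (T * (∫ t in (0 : ℝ)..T, g t ^ 2) - J ^ 2) := by nlinarith
  have := nonneg_of_mul_nonneg_right h3 h
  linarith

end IntervalIntegrals

/-! ### Mollified solutions and their initial energy -/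

section RegularSolutions

/-- A path `t ↦ (ψ t, π t)`, `L²`-continuous, with locally bounded `L²` norm of `π` and locally
bounded sup norm and Hölder constant of `ψ`. -/
structure RegularPath (ψ π : ℝ → ℝ → ℝ) : Prop where
  locallyIntegrable_snd : ∀ t, LocallyIntegrable (π t)
  bound : ∀ T : ℝ, ∃ B, 0 ≤ B ∧ ∀ t, |t| ≤ T → (∀ x y, (ψ t x - ψ t y) ^ 2 ≤ B * |x - y|) ∧
    (∀ x, |ψ t x| ≤ B) ∧ ∫⁻ x, ‖π t x‖ₑ ^ 2 ≤ ENNReal.ofReal B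
  tendsto_fst : ∀ t₀, Tendsto (fun t => ∫⁻ x, ‖ψ t x - ψ t₀ x‖ₑ ^ 2) (𝓝 t₀) (𝓝 0)
  tendsto_snd : ∀ t₀, Tendsto (fun t => ∫⁻ x, ‖π t x - π t₀ x‖ₑ ^ 2) (𝓝 t₀) (𝓝 0)

/-- A regular path solving `ψ̇ = π`, `π̇ = ψ'' + F(ψ)` when tested against smooth functions of the
space variable. -/
structure RegularSolution (F : ℝ → ℝ) (ψ π : ℝ → ℝ → ℝ) : Prop extends RegularPath ψ π where
  deriv_fst : ∀ η : ℝ → ℝ, ContDiff ℝ ∞ η → HasCompactSupport η → ∀ t,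
    HasDerivAt (fun τ => ∫ x, ψ τ x * η x) (∫ x, π t x * η x) t
  deriv_snd : ∀ η : ℝ → ℝ, ContDiff ℝ ∞ η → HasCompactSupport η → ∀ t,
    HasDerivAt (fun τ => ∫ x, π τ x * η x)
      ((∫ x, ψ t x * deriv (deriv η) x) + ∫ x, F (ψ t x) * η x) t

lemma contDiff_deriv {η : ℝ → ℝ} (h : ContDiff ℝ ∞ η) : ContDiff ℝ ∞ (deriv η) :=
  (contDiff_infty_iff_deriv.1 h).2

namespace RegularPath

variable {F : ℝ → ℝ} {ψ π : ℝ → ℝ → ℝ}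

lemma continuous_fst (h : RegularPath ψ π) (t : ℝ) : Continuous (ψ t) := by
  obtain ⟨B, _, hB⟩ := h.bound |t|
  exact continuous_of_holder (hB t le_rfl).1

/-- `ψ` is locally bounded in time and uniformly in space, so a Lipschitz constant of `F` on a
bounded interval suffices. -/
lemma tendsto_force (h : RegularPath ψ π) (hF : ContDiff ℝ ∞ F) (t₀ : ℝ) :
    Tendsto (fun t => ∫⁻ x, ‖F (ψ t x) - F (ψ t₀ x)‖ₑ ^ 2) (𝓝 t₀) (𝓝 0) := by
  obtain ⟨B, hB0, hB⟩ := h.bound (|t₀| + 1)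
  obtain ⟨L, hL0, hL⟩ := exists_lipschitz_on_Icc hF B
  have h1 : Tendsto (fun t => ENNReal.ofReal (L ^ 2) * ∫⁻ x, ‖ψ t x - ψ t₀ x‖ₑ ^ 2)
      (𝓝 t₀) (𝓝 0) := by
    simpa using ENNReal.Tendsto.const_mul (h.tendsto_fst t₀) (Or.inr ENNReal.ofReal_ne_top)
  refine tendsto_of_tendsto_of_tendsto_of_le_of_le' tendsto_const_nhds h1
    (Eventually.of_forall fun _ => zero_le) ?_
  filter_upwards [Metric.ball_mem_nhds t₀ one_pos] with t ht
  rw [← lintegral_const_mul' _ _ ENNReal.ofReal_ne_top]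
  refine lintegral_mono fun x => ?_
  rw [enorm_sq_eq_ofReal, enorm_sq_eq_ofReal, ← ENNReal.ofReal_mul (by positivity)]
  refine ENNReal.ofReal_le_ofReal ?_
  have ht' : |t| ≤ |t₀| + 1 := by
    have h2 : |t - t₀| < 1 := ht
    have h3 : |t| ≤ |t - t₀| + |t₀| := by simpa using abs_add_le (t - t₀) t₀
    linarith
  have h4 := hL (ψ t x) (ψ t₀ x) ((hB t ht').2.1 x) ((hB t₀ (by linarith)).2.1 x)
  rw [← sq_abs, ← sq_abs (ψ t x - ψ t₀ x), ← mul_pow]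
  exact pow_le_pow_left₀ (abs_nonneg _) h4 2

lemma continuous_mol_fst (h : RegularPath ψ π) {η : ℝ → ℝ} (hη : Continuous η)
    (hc : HasCompactSupport η) : Continuous fun p : ℝ × ℝ => mol η (ψ p.1) p.2 :=
  continuous_mol_uncurry hη hc (fun t => (h.continuous_fst t).locallyIntegrable) h.tendsto_fst

lemma continuous_mol_snd (h : RegularPath ψ π) {η : ℝ → ℝ} (hη : Continuous η)
    (hc : HasCompactSupport η) : Continuous fun p : ℝ × ℝ => mol η (π p.1) p.2 :=
  continuous_mol_uncurry hη hc h.locallyIntegrable_snd h.tendsto_snd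

lemma continuous_mol_force (h : RegularPath ψ π) (hF : ContDiff ℝ ∞ F) {η : ℝ → ℝ}
    (hη : Continuous η) (hc : HasCompactSupport η) :
    Continuous fun p : ℝ × ℝ => mol η (fun y => F (ψ p.1 y)) p.2 :=
  continuous_mol_uncurry hη hc
    (fun t => (hF.continuous.comp (h.continuous_fst t)).locallyIntegrable) (h.tendsto_force hF)

end RegularPath

namespace RegularSolution

variable {F : ℝ → ℝ} {ψ π : ℝ → ℝ → ℝ}

lemma hasDerivAt_mol_fst (h : RegularSolution F ψ π) {η : ℝ → ℝ} (hη : ContDiff ℝ ∞ η)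
    (hc : HasCompactSupport η) (t x : ℝ) :
    HasDerivAt (fun τ => mol η (ψ τ) x) (mol η (π t) x) t :=
  h.deriv_fst (fun y => η (x - y)) (by fun_prop) (hasCompactSupport_comp_sub hc x) t

lemma hasDerivAt_mol_snd (h : RegularSolution F ψ π) {η : ℝ → ℝ} (hη : ContDiff ℝ ∞ η)
    (hc : HasCompactSupport η) (t x : ℝ) :
    HasDerivAt (fun τ => mol η (π τ) x)
      (mol (deriv (deriv η)) (ψ t) x + mol η (fun y => F (ψ t y)) x) t := by
  have := h.deriv_snd (fun y => η (x - y)) (by fun_prop) (hasCompactSupport_comp_sub hc x) t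
  have e : deriv (deriv fun y => η (x - y)) = fun y => deriv (deriv η) (x - y) := by
    ext y
    rw [show deriv (fun y => η (x - y)) = fun y => -deriv η (x - y) from
      funext fun z => deriv_comp_sub η x z, deriv.fun_neg, deriv_comp_sub, neg_neg]
  rw [e] at this
  exact this

/-- The values `f y` with `|x - y| ≤ ε` and the average `mol ρ f x` all lie within `√(B * ε)` of `f
x`; the Lipschitz bound for `F` does the rest. -/
lemma abs_commutator_le {ρ f : ℝ → ℝ} {ε B L : ℝ} (hF : Continuous F) (hρ : IsMollifier ρ ε)
    (hB : 0 ≤ B) (hf : ∀ x y, (f x - f y) ^ 2 ≤ B * |x - y|) (hfB : ∀ x, |f x| ≤ B) (hL : 0 ≤ L)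
    (hFL : ∀ x y, |x| ≤ B → |y| ≤ B → |F x - F y| ≤ L * |x - y|) (x : ℝ) :
    |mol ρ (fun y => F (f y)) x - F (mol ρ f x)| ≤ 2 * L * √(B * ε) := by
  have hc := continuous_of_holder hf
  have hu : |mol ρ f x| ≤ B := by
    simpa using hρ.abs_mol_sub_le hc.locallyIntegrable (x := x) (c := 0) (δ := B)
      fun y _ => by simpa using hfB y
  refine hρ.abs_mol_sub_le (hF.comp hc).locallyIntegrable fun y hy => ?_
  refine (hFL _ _ (hfB y) hu).trans ?_
  have h1 : |f y - f x| ≤ √(B * ε) := by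
    rw [← Real.sqrt_sq_eq_abs]
    refine Real.sqrt_le_sqrt ((hf y x).trans ?_)
    rw [abs_sub_comm]
    gcongr
  have h2 := hρ.abs_mol_sub_self_le hB hf x
  have h3 : |f y - mol ρ f x| ≤ |f y - f x| + |mol ρ f x - f x| := by
    rw [abs_sub_comm (mol ρ f x)]
    exact abs_sub_le _ _ _
  nlinarith

end RegularSolution

lemma bracket_rpow_le_mul {P ε : ℝ} (hP : 0 ≤ P) (hε : ε ≤ 1) (x y : ℝ) (h : |x - y| ≤ ε) :
    ENNReal.ofReal (bracket x ^ P) ≤ ENNReal.ofReal (2 ^ P) * ENNReal.ofReal (bracket y ^ P) := by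
  rw [← ENNReal.ofReal_mul (by positivity), ← Real.mul_rpow (by norm_num) (bracket_pos y).le]
  refine ENNReal.ofReal_le_ofReal (Real.rpow_le_rpow (bracket_pos x).le ?_ hP)
  linarith [bracket_le_bracket_add x y, one_le_bracket y]

lemma continuous_bracket_rpow (P : ℝ) : Continuous fun x => bracket x ^ P :=
  continuous_bracket.rpow_const fun x => Or.inl (bracket_pos x).ne'

/-- A locally integrable `f` has `∫ (1 + x²)^(P/2) f² ≤ A`. -/
structure WeightedBound (P A : ℝ) (f : ℝ → ℝ) : Prop where
  nonneg : 0 ≤ A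
  locallyIntegrable : LocallyIntegrable f
  le : ∫⁻ x, ENNReal.ofReal (bracket x ^ P) * ‖f x‖ₑ ^ 2 ≤ ENNReal.ofReal A

lemma WeightedBound.mol {P A : ℝ} {f : ℝ → ℝ} (h : WeightedBound P A f) (hP : 0 ≤ P)
    {ρ : ℝ → ℝ} {ε : ℝ} (hρ : IsMollifier ρ ε) (hε : ε ≤ 1) :
    WeightedBound P (2 ^ P * A) (mol ρ f) where
  nonneg := mul_nonneg (by positivity) h.nonneg
  locallyIntegrable :=
    (continuous_mol h.locallyIntegrable hρ.smooth.continuous hρ.compact).locallyIntegrable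
  le := by
    rw [ENNReal.ofReal_mul (by positivity)]
    refine (hρ.lintegral_weight_mol_sq_le h.locallyIntegrable
      (continuous_bracket_rpow P).measurable.ennreal_ofReal (bracket_rpow_le_mul hP hε)).trans ?_
    gcongr
    exact h.le

lemma WeightedBound.intervalIntegral_le {P A : ℝ} {f : ℝ → ℝ} (h : WeightedBound P A f)
    (hf : Continuous f) {a b : ℝ} (hab : a ≤ b) : ∫ x in a..b, bracket x ^ P * f x ^ 2 ≤ A := by
  have hb := continuous_bracket_rpow P
  have hb0 : ∀ x, 0 ≤ bracket x ^ P := fun x => Real.rpow_nonneg (bracket_pos x).le _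
  refine intervalIntegral_le_of_lintegral_le (by fun_prop)
    (fun x => mul_nonneg (hb0 x) (sq_nonneg _)) h.nonneg (le_trans (le_of_eq ?_) h.le) hab
  refine lintegral_congr fun x => ?_
  rw [ENNReal.ofReal_mul (hb0 x), enorm_sq_eq_ofReal]

/-- The data of the initial state `(ψ₀, π₀)` that enter the energy estimate: `p₀` is the derivative
of `ψ₀`, `z` the perturbation, `D` the distance of the kink to the wells. -/
structure InitialBound (U : ℝ → ℝ) (P A M C : ℝ) (ψ₀ π₀ p₀ z D : ℝ → ℝ) : Prop where
  snd : WeightedBound P A π₀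
  deriv : WeightedBound P A p₀
  pert : WeightedBound P A z
  dist : WeightedBound P A D
  weak : HasWeakDeriv ψ₀ p₀
  continuous_pert : Continuous z
  continuous_dist : Continuous D
  bound : ∀ x, |ψ₀ x| ≤ M
  nonneg : 0 ≤ C
  potential : ∀ x y, |y| ≤ M → U y ≤ C * ((y - (ψ₀ x - z x)) ^ 2 + D x ^ 2)

/-- The constant in the bound of the initial weighted energy. -/
noncomputable def energyConst (P A C : ℝ) : ℝ := 2 ^ P * A + 3 * C * A

/-- The mollification error `(u - ψ₀)² ≤ B * ε` in the potential is only bounded, not integrable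
over the line. This produces the last term with its factor `2 * N`, which disappears as `ε → 0` for
fixed `N`. -/
lemma InitialBound.energy_le {U : ℝ → ℝ} {P A M C : ℝ} {ψ₀ π₀ p₀ z D : ℝ → ℝ} (hU : Continuous U)
    (hP : 0 ≤ P)
    (h : InitialBound U P A M C ψ₀ π₀ p₀ z D) {B : ℝ} (hB : 0 ≤ B)
    (hψ : ∀ x y, (ψ₀ x - ψ₀ y) ^ 2 ≤ B * |x - y|) {ρ : ℝ → ℝ} {ε : ℝ} (hρ : IsMollifier ρ ε)
    (hε : ε ≤ 1) {W : ℝ → ℝ} (hWc : Continuous W) {c N : ℝ} (hc : 0 ≤ c) (hN : 0 ≤ N)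
    (hW : ∀ x, W x ≤ c * bracket x ^ P) (hU0 : ∀ y, 0 ≤ U y) :
    ∫ x in (-N)..N, W x * energyDensity U (mol ρ ψ₀ x) (mol ρ π₀ x) (mol (_root_.deriv ρ) ψ₀ x) ≤
      c * energyConst P A C + 2 * N * (c * (1 + N) ^ P * (2 * C * (B * ε))) := by
  have hρc := hρ.smooth.continuous
  have hψc := continuous_of_holder hψ
  have cb := continuous_bracket_rpow P
  have hb0 : ∀ x, 0 ≤ bracket x ^ P := fun x => Real.rpow_nonneg (bracket_pos x).le _
  have cu : Continuous (mol ρ ψ₀) := continuous_mol hψc.locallyIntegrable hρc hρ.compact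
  have cv : Continuous (mol ρ π₀) :=
    continuous_mol h.snd.locallyIntegrable hρc hρ.compact
  have cp : Continuous (mol ρ p₀) :=
    continuous_mol h.deriv.locallyIntegrable hρc hρ.compact
  have cz := h.continuous_pert
  have cD := h.continuous_dist
  have eq : mol (_root_.deriv ρ) ψ₀ = mol ρ p₀ :=
    funext fun x => mol_deriv_of_hasWeakDeriv h.weak hρ.smooth hρ.compact x
  rw [eq]
  -- A kernel with `ε < 0` would vanish identically, against its unit mass.
  have hε0 : 0 ≤ ε := by
    by_contra! hneg
    have : ∀ x, ρ x = 0 := fun x => hρ.support x (hneg.trans_le (abs_nonneg x))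
    have h1 := hρ.integral
    simp [this] at h1
  set E := c * (1 + N) ^ P * (2 * C * (B * ε)) with hE
  have hpt : ∀ x ∈ Set.Icc (-N) N, W x * energyDensity U (mol ρ ψ₀ x) (mol ρ π₀ x) (mol ρ p₀ x) ≤
      c * ((bracket x ^ P * mol ρ π₀ x ^ 2) / 2 + (bracket x ^ P * mol ρ p₀ x ^ 2) / 2
        + 2 * C * (bracket x ^ P * z x ^ 2) + C * (bracket x ^ P * D x ^ 2)) + E := by
    intro x hx
    set u := mol ρ ψ₀ x
    have hu : |u| ≤ M := by
      simpa using hρ.abs_mol_sub_le hψc.locallyIntegrable (x := x) (c := 0) (δ := M)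
        fun y _ => by simpa using h.bound y
    have hd : (u - ψ₀ x) ^ 2 ≤ B * ε := by
      have := hρ.abs_mol_sub_self_le hB hψ x
      rw [← sq_abs, ← Real.sq_sqrt (by positivity : 0 ≤ B * ε)]
      exact pow_le_pow_left₀ (abs_nonneg _) this 2
    have hUu : U u ≤ C * (2 * (B * ε) + 2 * z x ^ 2 + D x ^ 2) := by
      refine (h.potential x u hu).trans (mul_le_mul_of_nonneg_left ?_ h.nonneg)
      nlinarith [sq_nonneg (u - ψ₀ x - z x)]
    have hbN : bracket x ^ P ≤ (1 + N) ^ P := by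
      refine Real.rpow_le_rpow (bracket_pos x).le ?_ hP
      linarith [bracket_le_one_add_abs x, abs_le.2 hx]
    have he0 : 0 ≤ energyDensity U u (mol ρ π₀ x) (mol ρ p₀ x) := by
      have := hU0 u
      rw [energyDensity]
      positivity
    have h1 : W x * energyDensity U u (mol ρ π₀ x) (mol ρ p₀ x) ≤
        c * bracket x ^ P * energyDensity U u (mol ρ π₀ x) (mol ρ p₀ x) :=
      mul_le_mul_of_nonneg_right (hW x) he0
    have h2 : c * bracket x ^ P * U u ≤
        c * bracket x ^ P * (C * (2 * (B * ε) + 2 * z x ^ 2 + D x ^ 2)) :=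
      mul_le_mul_of_nonneg_left hUu (mul_nonneg hc (hb0 x))
    have h3 : c * bracket x ^ P * (2 * C * (B * ε)) ≤ E := by
      have := h.nonneg
      rw [hE]
      gcongr
    rw [energyDensity] at h1 ⊢
    nlinarith
  have hcE : Continuous fun x => energyDensity U (mol ρ ψ₀ x) (mol ρ π₀ x) (mol ρ p₀ x) := by
    simp only [energyDensity]
    fun_prop
  have ii : ∀ {g : ℝ → ℝ}, Continuous g → IntervalIntegrable g volume (-N) N :=
    fun hg => hg.intervalIntegrable _ _
  refine (intervalIntegral.integral_mono_on (by linarith) (ii (by fun_prop)) (ii (by fun_prop))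
    hpt).trans ?_
  rw [intervalIntegral.integral_add (ii (by fun_prop)) (ii (by fun_prop)),
    intervalIntegral.integral_const_mul,
    intervalIntegral.integral_add (ii (by fun_prop)) (ii (by fun_prop)),
    intervalIntegral.integral_add (ii (by fun_prop)) (ii (by fun_prop)),
    intervalIntegral.integral_add (ii (by fun_prop)) (ii (by fun_prop)),
    intervalIntegral.integral_const_mul, intervalIntegral.integral_const_mul,
    intervalIntegral.integral_div, intervalIntegral.integral_div, intervalIntegral.integral_const]
  have i1 := (h.snd.mol hP hρ hε).intervalIntegral_le cv (by linarith : -N ≤ N)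
  have i2 := (h.deriv.mol hP hρ hε).intervalIntegral_le cp (by linarith : -N ≤ N)
  have i3 := mul_le_mul_of_nonneg_left
    (h.pert.intervalIntegral_le cz (by linarith : -N ≤ N)) h.nonneg
  have i4 := mul_le_mul_of_nonneg_left
    (h.dist.intervalIntegral_le cD (by linarith : -N ≤ N)) h.nonneg
  -- The two halves of `2 ^ P * A` come from the kinetic and gradient terms, `2 * C * A` from the
  -- perturbation and `C * A` from the distance to the wells.
  have hsum : (∫ x in (-N)..N, bracket x ^ P * mol ρ π₀ x ^ 2) / 2 +
      (∫ x in (-N)..N, bracket x ^ P * mol ρ p₀ x ^ 2) / 2 +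
      2 * C * (∫ x in (-N)..N, bracket x ^ P * z x ^ 2) +
      C * (∫ x in (-N)..N, bracket x ^ P * D x ^ 2) ≤ energyConst P A C := by
    rw [energyConst]
    linarith
  have := mul_le_mul_of_nonneg_left hsum hc
  rw [smul_eq_mul]
  linarith

end RegularSolutions

/-! ### The weighted estimate for regular solutions -/

section WeightedEstimate

open Real (smoothTransition)

variable {U F : ℝ → ℝ} {ψ π : ℝ → ℝ → ℝ} {P A M C : ℝ} {p₀ z D : ℝ → ℝ}

/-- The uniform commutator bound is paired with `|v| ≤ 1 + v²`, whose integral over `[-N, N]` is at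
most `2 * N + B`. -/
lemma RegularSolution.integral_weight_mul_commutator_le (h : RegularSolution F ψ π)
    (hF : ContDiff ℝ ∞ F) {ρ : ℝ → ℝ} {ε B L t N w : ℝ} (hρ : IsMollifier ρ ε) (hB : 0 ≤ B)
    (hψ : ∀ x y, (ψ t x - ψ t y) ^ 2 ≤ B * |x - y|) (hψB : ∀ x, |ψ t x| ≤ B)
    (hπ : ∫⁻ x, ‖π t x‖ₑ ^ 2 ≤ ENNReal.ofReal B) (hL : 0 ≤ L)
    (hFL : ∀ x y, |x| ≤ B → |y| ≤ B → |F x - F y| ≤ L * |x - y|) (hN : 0 ≤ N) {W : ℝ → ℝ}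
    (hWc : Continuous W) (hw : 0 ≤ w) (hW : ∀ x ∈ Set.Icc (-N) N, W x ≤ w) :
    ∫ x in (-N)..N, W x * (|mol ρ (π t) x| *
      |mol ρ (fun y => F (ψ t y)) x - F (mol ρ (ψ t) x)|) ≤
      w * (2 * L * √(B * ε)) * (2 * N + B) := by
  have hρc := hρ.smooth.continuous
  have cψ := h.continuous_fst t
  have cu : Continuous (mol ρ (ψ t)) := continuous_mol cψ.locallyIntegrable hρc hρ.compact
  have cv : Continuous (mol ρ (π t)) :=
    continuous_mol (h.locallyIntegrable_snd t) hρc hρ.compact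
  have cf : Continuous (mol ρ fun y => F (ψ t y)) :=
    continuous_mol (hF.continuous.comp cψ).locallyIntegrable hρc hρ.compact
  have cF := hF.continuous
  set δ := 2 * L * √(B * ε) with hδ
  have hδ0 : 0 ≤ δ := by positivity
  have hv2 : ∫ x in (-N)..N, mol ρ (π t) x ^ 2 ≤ B := by
    refine intervalIntegral_le_of_lintegral_le (by fun_prop) (fun x => sq_nonneg _) hB ?_
      (by linarith)
    have := hρ.lintegral_weight_mol_sq_le (h.locallyIntegrable_snd t) (w := fun _ => 1)
      measurable_const (K := 1) (fun _ _ _ => by simp)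
    simp only [one_mul] at this
    simp only [← enorm_sq_eq_ofReal]
    exact this.trans hπ
  have hpt : ∀ x ∈ Set.Icc (-N) N, W x * (|mol ρ (π t) x| *
      |mol ρ (fun y => F (ψ t y)) x - F (mol ρ (ψ t) x)|) ≤
      w * δ * (1 + mol ρ (π t) x ^ 2) := by
    intro x hx
    have h1 := RegularSolution.abs_commutator_le hF.continuous hρ hB hψ hψB hL hFL x
    have h2 : |mol ρ (π t) x| ≤ 1 + mol ρ (π t) x ^ 2 := by
      rw [← sq_abs (mol ρ (π t) x)]
      nlinarith [sq_nonneg (|mol ρ (π t) x| - 1), abs_nonneg (mol ρ (π t) x)]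
    calc W x * (|mol ρ (π t) x| * |mol ρ (fun y => F (ψ t y)) x - F (mol ρ (ψ t) x)|)
        ≤ w * ((1 + mol ρ (π t) x ^ 2) * δ) := by
          have := hW x hx
          gcongr
      _ = _ := by ring
  refine (intervalIntegral.integral_mono_on (by linarith)
    ((by fun_prop : Continuous _).intervalIntegrable _ _)
    ((by fun_prop : Continuous _).intervalIntegrable _ _) hpt).trans ?_
  rw [intervalIntegral.integral_const_mul, intervalIntegral.integral_add intervalIntegrable_const
    ((by fun_prop : Continuous _).intervalIntegrable _ _), intervalIntegral.integral_const]
  have : 0 ≤ w * δ := by positivity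
  refine mul_le_mul_of_nonneg_left ?_ this
  simp only [smul_eq_mul]
  linarith

/-- The weight of power growth `P` at the final time of the cone. -/
noncomputable def cutWeight (P N T x : ℝ) : ℝ :=
  bracket x ^ P * smoothTransition (N - bracket x - T)

lemma cutWeight_nonneg (P N T x : ℝ) : 0 ≤ cutWeight P N T x :=
  mul_nonneg (Real.rpow_nonneg (bracket_pos x).le _) (Real.smoothTransition.nonneg _)

lemma continuous_cutWeight (P N T : ℝ) : Continuous (cutWeight P N T) := by
  have := continuous_bracket_rpow P
  have := continuous_bracket
  have := Real.smoothTransition.continuous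
  unfold cutWeight
  fun_prop

lemma cutWeight_anti (P N x : ℝ) {t T : ℝ} (h : t ≤ T) : cutWeight P N T x ≤ cutWeight P N t x :=
  mul_le_mul_of_nonneg_left (Real.smoothTransition.monotone (by linarith))
    (Real.rpow_nonneg (bracket_pos x).le _)

/-- The energy inequality for the mollified fields, with the cone ending at time `t`. Only the first
term on the right survives `ε → 0`; it does not contain the solution-dependent constants `B` and
`L`. -/
lemma RegularSolution.mol_energy_le (h : RegularSolution F ψ π) (hU0 : ∀ y, 0 ≤ U y)
    (hU : ∀ y, HasDerivAt U (-F y) y) (hF : ContDiff ℝ ∞ F) (hP : 1 ≤ P)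
    (h0 : InitialBound U P A M C (ψ 0) (π 0) p₀ z D) {ρ : ℝ → ℝ} {ε B L t N : ℝ}
    (hρ : IsMollifier ρ ε) (hε : ε ≤ 1) (hB : 0 ≤ B)
    (hψ : ∀ τ ∈ Set.Icc 0 t, (∀ x y, (ψ τ x - ψ τ y) ^ 2 ≤ B * |x - y|) ∧
      (∀ x, |ψ τ x| ≤ B) ∧ ∫⁻ x, ‖π τ x‖ₑ ^ 2 ≤ ENNReal.ofReal B) (hL : 0 ≤ L)
    (hFL : ∀ x y, |x| ≤ B → |y| ≤ B → |F x - F y| ≤ L * |x - y|) (hN : 0 ≤ N) (ht : 0 ≤ t) :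
    ∫ x in (-N)..N, cutWeight P N t x * mol ρ (π t) x ^ 2 ≤
      2 * ((1 + t) ^ P * energyConst P A C +
        2 * N * ((1 + t) ^ P * (1 + N) ^ P * (2 * C * (B * ε))) +
        (1 + t) ^ P * (1 + N) ^ P * (2 * L * √(B * ε)) * (2 * N + B) * t) := by
  have hρc := hρ.smooth.continuous
  have hρ1 := contDiff_deriv hρ.smooth
  have hρ2 := contDiff_deriv hρ1
  have k1 : HasCompactSupport (deriv ρ) := hρ.compact.deriv
  have k2 : HasCompactSupport (deriv (deriv ρ)) := k1.deriv
  have lψ := fun t => (h.continuous_fst t).locallyIntegrable (μ := volume)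
  have h1t : 0 ≤ (1 + t) ^ P := by positivity
  have hW0 : ∀ τ ∈ Set.Icc 0 t, ∀ x, 0 ≤ coneWeight P t N τ x := fun τ hτ x =>
    coneWeight_nonneg hτ.2 N x
  have slice : ∀ τ, Continuous (coneWeight P t N τ) := fun τ =>
    (continuous_coneWeight hP t N).comp (by fun_prop : Continuous fun x : ℝ => (τ, x))
  have key := weighted_energy_le (U := U) (F := F) hU0 hU hF.continuous
    (u := fun τ => mol ρ (ψ τ)) (v := fun τ => mol ρ (π τ)) (q := fun τ => mol (deriv ρ) (ψ τ))
    (vx := fun τ => mol (deriv ρ) (π τ)) (qx := fun τ => mol (deriv (deriv ρ)) (ψ τ))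
    (f := fun τ => mol ρ fun y => F (ψ τ y)) (W := coneWeight P t N)
    (h.hasDerivAt_mol_fst hρ.smooth hρ.compact) (h.hasDerivAt_mol_snd hρ.smooth hρ.compact)
    (h.hasDerivAt_mol_fst hρ1 k1)
    (fun τ => hasDerivAt_mol (h.locallyIntegrable_snd τ) hρ.smooth hρ.compact)
    (fun τ => hasDerivAt_mol (lψ τ) hρ1 k1)
    (h.continuous_mol_fst hρc hρ.compact) (h.continuous_mol_snd hρc hρ.compact)
    (h.continuous_mol_fst hρ1.continuous k1) (h.continuous_mol_snd hρ1.continuous k1)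
    (h.continuous_mol_fst hρ2.continuous k2) (h.continuous_mol_force hF hρc hρ.compact)
    (hasDerivAt_coneWeight_time hP t N) (hasDerivAt_coneWeight_space hP t N)
    (continuous_coneWeight hP t N) (continuous_coneWeightT hP t N) (continuous_coneWeightX hP t N)
    ht hN hW0
    (fun τ hτ => ⟨coneWeight_eq_zero hτ.1 (le_abs_self N), coneWeight_eq_zero hτ.1 (by
      rw [abs_neg]; exact le_abs_self N)⟩)
    (fun τ hτ => coneWeightT_add_abs_le hP hτ.2 N)
    (fun τ hτ => h.integral_weight_mul_commutator_le hF (w := (1 + t) ^ P * (1 + N) ^ P) hρ hB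
      (hψ τ hτ).1 (hψ τ hτ).2.1 (hψ τ hτ).2.2 hL hFL hN (slice τ) (by positivity)
      (fun x hx => (coneWeight_le (by linarith) hτ.1 hτ.2 N x).trans (by
        refine mul_le_mul_of_nonneg_left
          (Real.rpow_le_rpow (bracket_pos x).le ?_ (by linarith)) h1t
        linarith [bracket_le_one_add_abs x, abs_le.2 hx])))
  have hinit := h0.energy_le (continuous_iff_continuousAt.2 fun y => (hU y).continuousAt)
    (by linarith) hB (hψ 0 ⟨le_rfl, ht⟩).1 hρ hε (slice 0) h1t hN
    (fun x => coneWeight_le (by linarith) le_rfl ht N x) hU0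
  have cv : Continuous (mol ρ (π t)) :=
    continuous_mol (h.locallyIntegrable_snd t) hρc hρ.compact
  have cu : Continuous (mol ρ (ψ t)) := continuous_mol (lψ t) hρc hρ.compact
  have cq : Continuous (mol (deriv ρ) (ψ t)) := continuous_mol (lψ t) hρ1.continuous k1
  have cw := continuous_cutWeight P N t
  have cU : Continuous U := continuous_iff_continuousAt.2 fun y => (hU y).continuousAt
  -- At the final time the base of the cone weight is just `bracket x`; the factor 2 undoes the one
  -- half in the kinetic term.
  have hend : (∫ x in (-N)..N, cutWeight P N t x * mol ρ (π t) x ^ 2) ≤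
      2 * ∫ x in (-N)..N, coneWeight P t N t x *
        energyDensity U (mol ρ (ψ t) x) (mol ρ (π t) x) (mol (deriv ρ) (ψ t) x) := by
    rw [← intervalIntegral.integral_const_mul]
    have ce : Continuous fun x =>
        energyDensity U (mol ρ (ψ t) x) (mol ρ (π t) x) (mol (deriv ρ) (ψ t) x) := by
      simp only [energyDensity]
      fun_prop
    have := slice t
    refine intervalIntegral.integral_mono_on (by linarith)
      ((by fun_prop : Continuous _).intervalIntegrable _ _)
      ((by fun_prop : Continuous _).intervalIntegrable _ _) fun x _ => ?_
    have e : coneWeight P t N t x = cutWeight P N t x := by simp [coneWeight, cutWeight]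
    rw [e, mul_left_comm]
    refine mul_le_mul_of_nonneg_left ?_ (cutWeight_nonneg _ _ _ _)
    rw [energyDensity]
    nlinarith [hU0 (mol ρ (ψ t) x), sq_nonneg (mol (deriv ρ) (ψ t) x)]
  linarith

/-- Cauchy–Schwarz in time for the integral of `π`, then Fubini. The cut-off weight decreases in its
time parameter, so the bound at time `t` also serves for the weight at time `T`. -/
lemma RegularSolution.integral_mol_displacement_le (h : RegularSolution F ψ π) {ρ : ℝ → ℝ}
    (hρ : ContDiff ℝ ∞ ρ) (hc : HasCompactSupport ρ) {T N R : ℝ} (hT : 0 ≤ T) (hN : 0 ≤ N)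
    (hR : ∀ t ∈ Set.Icc 0 T, ∫ x in (-N)..N, cutWeight P N t x * mol ρ (π t) x ^ 2 ≤ R) :
    ∫ x in (-N)..N, cutWeight P N T x * (mol ρ (ψ T) x - mol ρ (ψ 0) x) ^ 2 ≤ T ^ 2 * R := by
  have cu := h.continuous_mol_fst hρ.continuous hc
  have cv := h.continuous_mol_snd hρ.continuous hc
  have cw := continuous_cutWeight P N T
  have cut : ∀ t, Continuous (mol ρ (ψ t)) := fun t =>
    cu.comp (by fun_prop : Continuous fun x : ℝ => (t, x))
  have cvt : ∀ t, Continuous (mol ρ (π t)) := fun t =>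
    cv.comp (by fun_prop : Continuous fun x : ℝ => (t, x))
  have cvx : ∀ x, Continuous fun t => mol ρ (π t) x := fun x =>
    cv.comp (by fun_prop : Continuous fun t : ℝ => (t, x))
  set G : ℝ → ℝ → ℝ := fun x t => cutWeight P N T x * mol ρ (π t) x ^ 2 with hG
  have cG : Continuous (Function.uncurry G) := by
    have : Continuous fun p : ℝ × ℝ => mol ρ (π p.2) p.1 := cv.comp continuous_swap
    simp only [hG, Function.uncurry_def]
    fun_prop
  have cGx : Continuous fun x => ∫ t in (0 : ℝ)..T, G x t :=
    intervalIntegral.continuous_parametric_intervalIntegral_of_continuous' cG 0 T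
  have cGt : Continuous fun t => ∫ x in (-N)..N, G x t :=
    intervalIntegral.continuous_parametric_intervalIntegral_of_continuous'
      (f := fun t x => G x t) (cG.comp continuous_swap) (-N) N
  have hpt : ∀ x ∈ Set.Icc (-N) N,
      cutWeight P N T x * (mol ρ (ψ T) x - mol ρ (ψ 0) x) ^ 2 ≤ T * ∫ t in (0 : ℝ)..T, G x t := by
    intro x _
    have e := intervalIntegral.integral_eq_sub_of_hasDerivAt (a := 0) (b := T)
      (fun t _ => h.hasDerivAt_mol_fst hρ hc t x) ((cvx x).intervalIntegrable _ _)
    rw [← e]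
    simp only [hG]
    rw [intervalIntegral.integral_const_mul, mul_left_comm]
    exact mul_le_mul_of_nonneg_left (sq_intervalIntegral_le (cvx x) hT) (cutWeight_nonneg _ _ _ _)
  have hcT := cut T
  have hc0 := cut 0
  refine (intervalIntegral.integral_mono_on (by linarith)
    ((by fun_prop : Continuous _).intervalIntegrable _ _)
    ((by fun_prop : Continuous _).intervalIntegrable _ _) hpt).trans ?_
  rw [intervalIntegral.integral_const_mul, sq, mul_assoc]
  refine mul_le_mul_of_nonneg_left ?_ hT
  rw [intervalIntegral_intervalIntegral_swap
    ((cG.continuousOn.integrableOn_compact (isCompact_uIcc.prod isCompact_uIcc)).mono_set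
      (Set.prod_mono Set.uIoc_subset_uIcc Set.uIoc_subset_uIcc))]
  have hle : ∀ t ∈ Set.Icc 0 T, ∫ x in (-N)..N, G x t ≤ R := by
    intro t ht
    refine le_trans ?_ (hR t ht)
    have := cvt t
    have := continuous_cutWeight P N t
    refine intervalIntegral.integral_mono_on (by linarith)
      ((by fun_prop : Continuous _).intervalIntegrable _ _)
      ((by fun_prop : Continuous _).intervalIntegrable _ _) fun x _ => ?_
    exact mul_le_mul_of_nonneg_right (cutWeight_anti P N x ht.2) (sq_nonneg _)
  refine (intervalIntegral.integral_mono_on hT (cGt.intervalIntegrable _ _)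
    intervalIntegrable_const hle).trans_eq ?_
  simp

lemma RegularSolution.exists_mollifier_displacement_le (h : RegularSolution F ψ π)
    (hU0 : ∀ y, 0 ≤ U y) (hU : ∀ y, HasDerivAt U (-F y) y) (hF : ContDiff ℝ ∞ F) (hP : 1 ≤ P)
    (hA : 0 ≤ A) (h0 : InitialBound U P A M C (ψ 0) (π 0) p₀ z D) {T N δ : ℝ} (hT : 0 ≤ T)
    (hN : 0 ≤ N) (hδ : 0 < δ) :
    ∃ d : ℝ → ℝ, Continuous d ∧ (∀ x, |d x - (ψ T x - ψ 0 x)| ≤ δ) ∧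
      ∫ x in (-N)..N, cutWeight P N T x * d x ^ 2 ≤
        T ^ 2 * (2 * (1 + T) ^ P * energyConst P A C + 1) := by
  obtain ⟨B, hB, hψ⟩ := h.bound T
  obtain ⟨L, hL, hFL⟩ := exists_lipschitz_on_Icc hF B
  have hψ' : ∀ τ ∈ Set.Icc 0 T, (∀ x y, (ψ τ x - ψ τ y) ^ 2 ≤ B * |x - y|) ∧
      (∀ x, |ψ τ x| ≤ B) ∧ ∫⁻ x, ‖π τ x‖ₑ ^ 2 ≤ ENNReal.ofReal B := fun τ hτ =>
    hψ τ (by rw [abs_of_nonneg hτ.1]; exact hτ.2)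
  have hC := h0.nonneg
  have hE : 0 ≤ energyConst P A C := by rw [energyConst]; positivity
  -- With `N`, `T`, `B`, `L` fixed this tends to zero with `ε`, so it can be made at most 1.
  set err : ℝ → ℝ := fun ε => 2 * (2 * N * ((1 + T) ^ P * (1 + N) ^ P * (2 * C * (B * ε))) +
        (1 + T) ^ P * (1 + N) ^ P * (2 * L * √(B * ε)) * (2 * N + B) * T) with herr
  have l1 : Tendsto err (𝓝[>] 0) (𝓝 0) := by
    have : Continuous err := by fun_prop
    have := this.tendsto 0
    simp only [herr, mul_zero, Real.sqrt_zero, zero_mul, add_zero] at this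
    exact this.mono_left nhdsWithin_le_nhds
  have l2 : Tendsto (fun ε => √(B * ε)) (𝓝[>] 0) (𝓝 0) := by
    have : Continuous fun ε => √(B * ε) := by fun_prop
    have := this.tendsto 0
    simp only [mul_zero, Real.sqrt_zero] at this
    exact this.mono_left nhdsWithin_le_nhds
  obtain ⟨ε, ⟨e1, e2⟩, ⟨hε0, hε1⟩⟩ := ((l1.eventually (eventually_le_nhds one_pos)).and
    (l2.eventually (eventually_le_nhds (half_pos hδ)))).and
    (Ioc_mem_nhdsGT (one_pos : (0 : ℝ) < 1)) |>.exists
  obtain ⟨ρ, hρ⟩ := exists_isMollifier hε0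
  have cψ := fun t => (h.continuous_fst t).locallyIntegrable (μ := volume)
  refine ⟨fun x => mol ρ (ψ T) x - mol ρ (ψ 0) x,
    (continuous_mol (cψ T) hρ.smooth.continuous hρ.compact).sub
      (continuous_mol (cψ 0) hρ.smooth.continuous hρ.compact), fun x => ?_, ?_⟩
  · have h1 := abs_le.1 (hρ.abs_mol_sub_self_le hB (hψ' T ⟨hT, le_rfl⟩).1 x)
    have h2 := abs_le.1 (hρ.abs_mol_sub_self_le hB (hψ' 0 ⟨le_rfl, hT⟩).1 x)
    rw [abs_le]
    constructor <;> linarith [h1.1, h1.2, h2.1, h2.2]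
  · refine h.integral_mol_displacement_le hρ.smooth hρ.compact hT hN fun t ht => ?_
    have ht0 := ht.1
    have htT := ht.2
    refine (h.mol_energy_le hU0 hU hF hP h0 hρ hε1 hB
      (fun τ hτ => hψ' τ ⟨hτ.1, hτ.2.trans htT⟩) hL hFL hN ht0).trans ?_
    have hpow : (1 + t) ^ P ≤ (1 + T) ^ P :=
      Real.rpow_le_rpow (by linarith) (by linarith) (by linarith)
    calc _ ≤ 2 * ((1 + T) ^ P * energyConst P A C +
          2 * N * ((1 + T) ^ P * (1 + N) ^ P * (2 * C * (B * ε))) +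
          (1 + T) ^ P * (1 + N) ^ P * (2 * L * √(B * ε)) * (2 * N + B) * T) := by gcongr
      _ = 2 * (1 + T) ^ P * energyConst P A C + err ε := by
          rw [herr]
          ring
      _ ≤ _ := by linarith

/-- Fatou's lemma along `N = n`, `δ = 1 / (n + 1)`: the cutoffs tend to 1 and the mollified
displacements to the true one. Finiteness of the weighted norm at time `T` is thus a conclusion, not
an assumption. -/
lemma RegularSolution.lintegral_displacement_le (h : RegularSolution F ψ π)
    (hU0 : ∀ y, 0 ≤ U y) (hU : ∀ y, HasDerivAt U (-F y) y) (hF : ContDiff ℝ ∞ F) (hP : 1 ≤ P)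
    (hA : 0 ≤ A) (h0 : InitialBound U P A M C (ψ 0) (π 0) p₀ z D) {T : ℝ} (hT : 0 ≤ T) :
    ∫⁻ x, ENNReal.ofReal (bracket x ^ P * (ψ T x - ψ 0 x) ^ 2) ≤
      ENNReal.ofReal (T ^ 2 * (2 * (1 + T) ^ P * energyConst P A C + 1)) := by
  have hex : ∀ n : ℕ, _ := fun n => h.exists_mollifier_displacement_le (T := T) (N := n)
    (δ := 1 / ((n : ℝ) + 1)) hU0 hU hF hP hA h0 hT (Nat.cast_nonneg n) (by positivity)
  choose d hdc hd hdI using hex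
  have hw0 := fun n : ℕ => cutWeight_nonneg P n T
  have hcont : ∀ n : ℕ, Continuous fun x => cutWeight P n T x * d n x ^ 2 := fun n => by
    have := continuous_cutWeight P n T
    have := hdc n
    fun_prop
  have hlim : ∀ x, Tendsto (fun n : ℕ => ENNReal.ofReal (cutWeight P n T x * d n x ^ 2)) atTop
      (𝓝 (ENNReal.ofReal (bracket x ^ P * (ψ T x - ψ 0 x) ^ 2))) := by
    intro x
    have h1 : Tendsto (fun n => d n x) atTop (𝓝 (ψ T x - ψ 0 x)) := by
      rw [tendsto_iff_dist_tendsto_zero]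
      exact squeeze_zero (fun _ => dist_nonneg) (fun n => hd n x)
        tendsto_one_div_add_atTop_nhds_zero_nat
    refine ENNReal.tendsto_ofReal (Tendsto.mul ?_ (h1.pow 2))
    refine tendsto_const_nhds.congr' ?_
    filter_upwards [tendsto_natCast_atTop_atTop.eventually_ge_atTop (bracket x + T + 1)] with n hn
    rw [cutWeight, Real.smoothTransition.one_of_one_le (by linarith), mul_one]
  calc ∫⁻ x, ENNReal.ofReal (bracket x ^ P * (ψ T x - ψ 0 x) ^ 2)
      = ∫⁻ x, liminf (fun n : ℕ => ENNReal.ofReal (cutWeight P n T x * d n x ^ 2)) atTop :=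
        lintegral_congr fun x => (hlim x).liminf_eq.symm
    _ ≤ liminf (fun n : ℕ => ∫⁻ x, ENNReal.ofReal (cutWeight P n T x * d n x ^ 2)) atTop :=
        lintegral_liminf_le fun n => (hcont n).measurable.ennreal_ofReal
    _ ≤ _ := by
        refine liminf_le_of_frequently_le' (Eventually.of_forall fun n => ?_).frequently
        refine lintegral_le_of_intervalIntegral_le (hcont n)
          (fun x => mul_nonneg (hw0 n x) (sq_nonneg _)) (Nat.cast_nonneg n) (fun x hx => ?_)
          (hdI n)
        rw [cutWeight, Real.smoothTransition.zero_of_nonpos, mul_zero, zero_mul]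
        linarith [abs_le_bracket x]

end WeightedEstimate

/-! ### Weak derivatives and sums of squares -/

section WeakDerivatives

lemma HasWeakDeriv.congr {f f' g : ℝ → ℝ} (h : HasWeakDeriv f g) (hf : ∀ᵐ x, f x = f' x) :
    HasWeakDeriv f' g := by
  refine ⟨h.1.congr hf, h.2.1, fun φ h1 h2 => ?_⟩
  rw [← h.2.2 φ h1 h2]
  refine integral_congr_ae ?_
  filter_upwards [hf] with x hx
  rw [hx]

lemma HasWeakDeriv.add {f g f' g' : ℝ → ℝ} (h : HasWeakDeriv f g) (h' : HasWeakDeriv f' g') :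
    HasWeakDeriv (fun x => f x + f' x) (fun x => g x + g' x) := by
  refine ⟨h.1.add h'.1, h.2.1.add h'.2.1, fun φ h1 h2 => ?_⟩
  have i : ∀ {f φ : ℝ → ℝ}, LocallyIntegrable f → Continuous φ → HasCompactSupport φ →
      Integrable fun x => f x * φ x := fun hf hφ hc => by
    simpa using hf.integrable_smul_right_of_hasCompactSupport hφ hc
  have hd := h1.continuous_deriv (by simp)
  simp only [add_mul]
  rw [integral_add (i h.1 hd h2.deriv) (i h'.1 hd h2.deriv),
    integral_add (i h.2.1 h1.continuous h2) (i h'.2.1 h1.continuous h2), h.2.2 φ h1 h2,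
    h'.2.2 φ h1 h2, neg_add]

lemma hasWeakDeriv_of_hasDerivAt {f g : ℝ → ℝ} (h : ∀ x, HasDerivAt f (g x) x)
    (hg : Continuous g) : HasWeakDeriv f g := by
  have hf : Continuous f := continuous_iff_continuousAt.2 fun x => (h x).continuousAt
  refine ⟨hf.locallyIntegrable, hg.locallyIntegrable, fun φ h1 h2 => ?_⟩
  have i : ∀ {f φ : ℝ → ℝ}, Continuous f → Continuous φ → HasCompactSupport φ →
      Integrable fun x => f x * φ x := fun hf hφ hc =>
    (hf.mul hφ).integrable_of_hasCompactSupport hc.mul_left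
  exact integral_mul_deriv_eq_deriv_mul_of_integrable (fun x _ => h x)
    (fun x _ => (h1.differentiable (by simp) x).hasDerivAt)
    (i hf (h1.continuous_deriv (by simp)) h2.deriv) (i hg h1.continuous h2)
    (i hf h1.continuous h2)

lemma lintegral_enorm_add_sq_le {f g : ℝ → ℝ} {w : ℝ → ℝ≥0∞} (hw : Measurable w)
    (hf : AEStronglyMeasurable f) :
    ∫⁻ x, w x * ‖f x + g x‖ₑ ^ 2 ≤
      2 * (∫⁻ x, w x * ‖f x‖ₑ ^ 2) + 2 * ∫⁻ x, w x * ‖g x‖ₑ ^ 2 := by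
  rw [← lintegral_const_mul' _ _ (by norm_num), ← lintegral_const_mul' _ _ (by norm_num),
    ← lintegral_add_left' ((hw.aemeasurable.fun_mul (hf.enorm.pow_const 2)).const_mul _)]
  refine lintegral_mono fun x => ?_
  rw [mul_left_comm, mul_left_comm 2, ← mul_add]
  refine mul_le_mul_right ?_ _
  simp only [enorm_sq_eq_ofReal]
  rw [← ENNReal.ofReal_ofNat 2, ← ENNReal.ofReal_mul (by norm_num),
    ← ENNReal.ofReal_mul (by norm_num), ← ENNReal.ofReal_add (by positivity) (by positivity)]
  refine ENNReal.ofReal_le_ofReal ?_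
  nlinarith [sq_nonneg (f x - g x)]

lemma lintegral_enorm_add_sq_le_ofReal {f g : ℝ → ℝ} (hf : AEStronglyMeasurable f) {A B : ℝ}
    (hA : 0 ≤ A) (hB : 0 ≤ B) (hfA : ∫⁻ x, ‖f x‖ₑ ^ 2 ≤ ENNReal.ofReal A)
    (hgB : ∫⁻ x, ‖g x‖ₑ ^ 2 ≤ ENNReal.ofReal B) :
    ∫⁻ x, ‖f x + g x‖ₑ ^ 2 ≤ ENNReal.ofReal (2 * A + 2 * B) := by
  have h := lintegral_enorm_add_sq_le (g := g) (w := fun _ => 1) measurable_const hf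
  simp only [one_mul] at h
  refine h.trans ?_
  rw [ENNReal.ofReal_add (by positivity) (by positivity), ENNReal.ofReal_mul (by norm_num),
    ENNReal.ofReal_mul (by norm_num), ENNReal.ofReal_ofNat]
  gcongr

lemma eq_of_ae_eq_of_continuous {f g : ℝ → ℝ} (hf : Continuous f) (hg : Continuous g)
    (h : ∀ᵐ x, f x = g x) : f = g :=
  (Continuous.ae_eq_iff_eq volume hf hg).1 h

end WeakDerivatives

/-! ### The weighted norms in terms of square integrals -/

section WeightedNorms

lemma eLpNorm_two_sq {f : ℝ → ℝ} : eLpNorm f 2 volume ^ 2 = ∫⁻ x, ‖f x‖ₑ ^ 2 := by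
  rw [eLpNorm_eq_lintegral_rpow_enorm_toReal (by norm_num) (by norm_num), ← ENNReal.rpow_natCast,
    ← ENNReal.rpow_mul]
  norm_num

lemma normL2_sq (σ : ℝ) (f : ℝ → ℝ) :
    normL2 σ f ^ 2 = ∫⁻ x, ENNReal.ofReal ((1 + |x|) ^ (2 * σ)) * ‖f x‖ₑ ^ 2 := by
  rw [normL2, eLpNorm_two_sq]
  refine lintegral_congr fun x => ?_
  have h0 : 0 ≤ 1 + |x| := by positivity
  rw [weighted, enorm_mul, mul_pow, enorm_sq_eq_ofReal, ← Real.rpow_natCast, ← Real.rpow_mul h0,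
    Nat.cast_ofNat, mul_comm σ 2]

lemma normL2_zero_sq (f : ℝ → ℝ) : normL2 0 f ^ 2 = ∫⁻ x, ‖f x‖ₑ ^ 2 := by
  simp [normL2_sq]

lemma le_of_sq_le_sq_ofReal {a : ℝ≥0∞} {r : ℝ} (hr : 0 ≤ r) (h : a ^ 2 ≤ ENNReal.ofReal (r ^ 2)) :
    a ≤ ENNReal.ofReal r := by
  rw [ENNReal.ofReal_pow hr] at h
  exact (ENNReal.pow_le_pow_left_iff (by norm_num)).1 h

lemma normL2_zero_le (σ : ℝ) (hσ : 0 ≤ σ) (f : ℝ → ℝ) : normL2 0 f ^ 2 ≤ normL2 σ f ^ 2 := by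
  rw [normL2_zero_sq, normL2_sq]
  refine lintegral_mono fun x => ?_
  refine le_mul_of_one_le_left' ?_
  rw [ENNReal.one_le_ofReal]
  exact Real.one_le_rpow (by linarith [abs_nonneg x]) (by linarith)

lemma weightedBound_of_normL2_le {σ : ℝ} (hσ : 0 ≤ σ) {f : ℝ → ℝ} (hf : LocallyIntegrable f)
    {r : ℝ} (h : normL2 σ f ≤ ENNReal.ofReal r) (hr : 0 ≤ r) :
    WeightedBound (2 * σ) (r ^ 2) f where
  nonneg := sq_nonneg r
  locallyIntegrable := hf
  le := by
    have h1 := pow_le_pow_left' h 2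
    rw [normL2_sq, ← ENNReal.ofReal_pow hr] at h1
    refine le_trans (lintegral_mono fun x => ?_) h1
    refine mul_le_mul_left (ENNReal.ofReal_le_ofReal ?_) _
    exact Real.rpow_le_rpow (bracket_pos x).le (bracket_le_one_add_abs x) (by linarith)

lemma normL2_sq_le {σ : ℝ} (hσ : 0 ≤ σ) (f : ℝ → ℝ) :
    normL2 σ f ^ 2 ≤
      ENNReal.ofReal (2 ^ (2 * σ)) * ∫⁻ x, ENNReal.ofReal (bracket x ^ (2 * σ) * f x ^ 2) := by
  rw [normL2_sq, ← lintegral_const_mul' _ _ ENNReal.ofReal_ne_top]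
  refine lintegral_mono fun x => ?_
  rw [enorm_sq_eq_ofReal, ← ENNReal.ofReal_mul (by positivity),
    ← ENNReal.ofReal_mul (by positivity), ← mul_assoc,
    ← Real.mul_rpow (by norm_num) (bracket_pos x).le]
  refine ENNReal.ofReal_le_ofReal (mul_le_mul_of_nonneg_right ?_ (sq_nonneg _))
  refine Real.rpow_le_rpow (by positivity) ?_ (by linarith)
  linarith [one_le_bracket x, abs_le_bracket x]

lemma normL2_add_le (σ : ℝ) {f g : ℝ → ℝ} (hf : AEStronglyMeasurable f)
    (hg : AEStronglyMeasurable g) :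
    normL2 σ (fun x => f x + g x) ≤ normL2 σ f + normL2 σ g := by
  have hw : Continuous fun x : ℝ => (1 + |x|) ^ σ :=
    (by fun_prop : Continuous fun x : ℝ => 1 + |x|).rpow_const
      fun x => Or.inl (by positivity)
  have m : ∀ {f : ℝ → ℝ}, AEStronglyMeasurable f → AEStronglyMeasurable (weighted σ f) :=
    fun hf => hw.aestronglyMeasurable.mul hf
  have e : weighted σ (fun x => f x + g x) = weighted σ f + weighted σ g := by
    ext x
    simp [weighted, mul_add]
  rw [normL2, e]
  exact eLpNorm_add_le (m hf) (m hg) (by norm_num)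

lemma weighted_zero (f : ℝ → ℝ) : weighted 0 f = f := by
  ext x
  simp [weighted]

/-- The strict inequality extracts an actual weak derivative from the infimum. -/
lemma exists_weakDeriv_of_normH1_lt {σ : ℝ} {f : ℝ → ℝ} {r : ℝ≥0∞} (h : normH1 σ f < r) :
    ∃ g, HasWeakDeriv f g ∧ normL2 σ f < r ∧ normL2 σ g < r := by
  rw [normH1] at h
  simp only [iInf_lt_iff] at h
  obtain ⟨g, hg, hr⟩ := h
  exact ⟨g, hg, le_self_add.trans_lt hr, le_add_self.trans_lt hr⟩

lemma normL2_le_normE_fst (σ : ℝ) (f g : ℝ → ℝ) : normL2 σ f ≤ normE σ f g :=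
  le_trans (le_iInf₂ fun _ _ => le_self_add) le_self_add

lemma normL2_le_normE_snd (σ : ℝ) (f g : ℝ → ℝ) : normL2 σ g ≤ normE σ f g := le_add_self

end WeightedNorms

/-! ### From distributional to regular solutions -/

section Regularity

variable {U : ℝ → ℝ} {a m k : ℝ} {s : ℝ → ℝ} {ψ π : ℝ → ℝ → ℝ}

/-- The `H¹ ⊕ L²` size of a state is bounded by `B`. -/
def StateBound (B : ℝ) (z π : ℝ → ℝ) : Prop :=
  AEStronglyMeasurable π ∧ ∫⁻ x, ‖z x‖ₑ ^ 2 ≤ ENNReal.ofReal B ∧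
    ∫⁻ x, ‖π x‖ₑ ^ 2 ≤ ENNReal.ofReal B ∧
    ∃ g, HasWeakDeriv z g ∧ ∫⁻ x, ‖g x‖ₑ ^ 2 ≤ ENNReal.ofReal B

lemma StateBound.mono {B B' : ℝ} {z π : ℝ → ℝ} (h : StateBound B z π) (hB : B ≤ B') :
    StateBound B' z π := by
  obtain ⟨h1, h2, h3, g, hg, h4⟩ := h
  have := ENNReal.ofReal_le_ofReal hB
  exact ⟨h1, h2.trans this, h3.trans this, g, hg, h4.trans this⟩

lemma StateBound.add {B B' : ℝ} {z π z' π' : ℝ → ℝ} (hB : 0 ≤ B) (hB' : 0 ≤ B')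
    (h : StateBound B z π) (h' : StateBound B' z' π') :
    StateBound (2 * B + 2 * B') (fun x => z x + z' x) (fun x => π x + π' x) := by
  obtain ⟨h1, h2, h3, g, hg, h4⟩ := h
  obtain ⟨h1', h2', h3', g', hg', h4'⟩ := h'
  exact ⟨h1.add h1', lintegral_enorm_add_sq_le_ofReal hg.1.aestronglyMeasurable hB hB' h2 h2',
    lintegral_enorm_add_sq_le_ofReal h1 hB hB' h3 h3', _, hg.add hg',
    lintegral_enorm_add_sq_le_ofReal hg.2.1.aestronglyMeasurable hB hB' h4 h4'⟩

lemma exists_ofReal_bound {c : ℝ≥0∞} (h : c < ⊤) : c ≤ ENNReal.ofReal c.toReal :=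
  (ENNReal.ofReal_toReal h.ne).ge

lemma MemE.exists_stateBound {z π : ℝ → ℝ} (h : MemE 0 z π) : ∃ B, 0 ≤ B ∧ StateBound B z π := by
  obtain ⟨g, hg, hgm⟩ := h.mem_deriv
  have h1 := h.mem_fst
  have h2 := h.mem_snd
  rw [weighted_zero] at h1 h2 hgm
  have fin : ∀ {f : ℝ → ℝ}, MemLp f 2 volume → ∫⁻ x, ‖f x‖ₑ ^ 2 < ⊤ := fun hf => by
    rw [← eLpNorm_two_sq]
    exact ENNReal.pow_lt_top hf.2
  refine ⟨(∫⁻ x, ‖z x‖ₑ ^ 2).toReal + (∫⁻ x, ‖π x‖ₑ ^ 2).toReal + (∫⁻ x, ‖g x‖ₑ ^ 2).toReal,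
    by positivity, h2.1, (exists_ofReal_bound (fin h1)).trans (ENNReal.ofReal_le_ofReal ?_),
    (exists_ofReal_bound (fin h2)).trans (ENNReal.ofReal_le_ofReal ?_), g, hg,
    (exists_ofReal_bound (fin hgm)).trans (ENNReal.ofReal_le_ofReal ?_)⟩
  all_goals
    have := (∫⁻ x, ‖z x‖ₑ ^ 2).toReal_nonneg
    have := (∫⁻ x, ‖π x‖ₑ ^ 2).toReal_nonneg
    have := (∫⁻ x, ‖g x‖ₑ ^ 2).toReal_nonneg
    linarith

lemma sq_le_one_of_lt {c : ℝ≥0∞} (h : c < 1) : c ^ 2 ≤ ENNReal.ofReal 1 := by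
  rw [ENNReal.ofReal_one]
  exact pow_le_one₀ zero_le h.le

/-- Continuity in the energy metric gives a bound near each time, and compactness of `[-T, T]` makes
it uniform. -/
lemma IsSolution.exists_stateBound (h : IsSolution U s ψ π) (T : ℝ) :
    ∃ B, 0 ≤ B ∧ ∀ t, |t| ≤ T → StateBound B (fun x => ψ t x - s x) (π t) := by
  have key : ∃ B, 0 ≤ B ∧ ∀ t ∈ Set.Icc (-T) T, StateBound B (fun x => ψ t x - s x) (π t) := by
    refine (isCompact_Icc (a := -T) (b := T)).induction_on
      (p := fun S => ∃ B, 0 ≤ B ∧ ∀ t ∈ S, StateBound B (fun x => ψ t x - s x) (π t))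
      ⟨0, le_rfl, by simp⟩ ?_ ?_ ?_
    · rintro S S' hS ⟨B, hB, h'⟩
      exact ⟨B, hB, fun t ht => h' t (hS ht)⟩
    · rintro S S' ⟨B, hB, h1⟩ ⟨B', hB', h2⟩
      refine ⟨B + B', by positivity, fun t ht => ?_⟩
      rcases ht with ht | ht
      · exact (h1 t ht).mono (by linarith)
      · exact (h2 t ht).mono (by linarith)
    · intro t₀ _
      obtain ⟨B, hB, hB'⟩ := (h.mem_phase t₀).exists_stateBound
      refine ⟨_, mem_nhdsWithin_of_mem_nhds ((h.continuous t₀).eventually (gt_mem_nhds one_pos)),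
        2 * B + 2 * 1, by positivity, fun t ht => ?_⟩
      have ht : normE 0 (fun x => ψ t x - ψ t₀ x) (fun x => π t x - π t₀ x) < 1 := ht
      obtain ⟨g, hg, hg1, hg2⟩ := exists_weakDeriv_of_normH1_lt (le_self_add.trans_lt ht)
      have h1 : StateBound 1 (fun x => ψ t x - ψ t₀ x) (fun x => π t x - π t₀ x) := by
        have m : ∀ t, AEStronglyMeasurable (π t) := fun t => by
          have := (h.mem_phase t).mem_snd.1
          rwa [weighted_zero] at this
        refine ⟨(m t).sub (m t₀), ?_, ?_, g, hg, ?_⟩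
        · rw [← normL2_zero_sq]
          exact sq_le_one_of_lt hg1
        · rw [← normL2_zero_sq]
          exact sq_le_one_of_lt ((normL2_le_normE_snd _ _ _).trans_lt ht)
        · rw [← normL2_zero_sq]
          exact sq_le_one_of_lt hg2
      have h2 := hB'.add hB zero_le_one h1
      simpa using h2
  obtain ⟨B, hB, h'⟩ := key
  exact ⟨B, hB, fun t ht => h' t (abs_le.1 ht)⟩

lemma IsKink.exists_lintegral_deriv_le (hU0 : ∀ y, 0 ≤ U y) (hs : IsKink U a s) :
    ∃ B, 0 ≤ B ∧ ∫⁻ x, ‖deriv s x‖ₑ ^ 2 ≤ ENNReal.ofReal B := by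
  have h1 : ∫⁻ x, ‖deriv s x‖ₑ ^ 2 ≤ ∫⁻ x, ENNReal.ofReal (2 * (deriv s x ^ 2 / 2 + U (s x))) := by
    refine lintegral_mono fun x => ?_
    rw [enorm_sq_eq_ofReal]
    refine ENNReal.ofReal_le_ofReal ?_
    linarith [hU0 (s x)]
  have h2 := (hs.finite_energy.const_mul 2).lintegral_lt_top
  exact ⟨_, ENNReal.toReal_nonneg, exists_ofReal_bound (h1.trans_lt h2)⟩

lemma IsKink.hasWeakDeriv (hs : IsKink U a s) : HasWeakDeriv s (deriv s) :=
  hasWeakDeriv_of_hasDerivAt hs.hasDerivAt hs.continuous_deriv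

lemma StateBound.abs_le {B : ℝ} {z π z' : ℝ → ℝ} (hB : 0 ≤ B) (h : StateBound B z π)
    (hz : Continuous z') (he : ∀ᵐ x, z x = z' x) (x : ℝ) : |z' x| ≤ 2 * √B := by
  obtain ⟨_, h2, _, g, hg, h4⟩ := h
  obtain ⟨f, hf, hol⟩ := (hg.congr he).exists_holder hB h4
  have e := eq_of_ae_eq_of_continuous hz (continuous_of_holder hol) hf
  rw [← e] at hol
  have h5 : ∫⁻ x, ‖z' x‖ₑ ^ 2 ≤ ENNReal.ofReal B := by
    refine le_trans (le_of_eq (lintegral_congr_ae ?_)) h2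
    filter_upwards [he] with x hx
    rw [hx]
  have h6 := sq_le_of_holder hB hB hol h5 x
  refine abs_le_of_sq_le_sq ?_ (by positivity)
  rw [mul_pow, Real.sq_sqrt hB]
  linarith

lemma tendsto_zero_of_sq_le {f : ℝ → ℝ≥0∞} {g : ℝ → ℝ≥0∞} {t₀ : ℝ}
    (hg : Tendsto g (𝓝 t₀) (𝓝 0)) (h : ∀ t, f t ≤ g t ^ 2) : Tendsto f (𝓝 t₀) (𝓝 0) := by
  have h1 : Tendsto (fun t => g t ^ 2) (𝓝 t₀) (𝓝 0) := by
    simpa [Function.comp_def] using (ENNReal.continuous_pow 2).tendsto 0 |>.comp hg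
  exact tendsto_of_tendsto_of_tendsto_of_le_of_le tendsto_const_nhds h1 (fun _ => zero_le) h

/-- Both `ψ - s` and `s` have square integrable weak derivatives, so each `ψ t` has a continuous
1/2-Hölder representative. Continuity makes this representative unique, so the bounds found on each
time interval apply to the same function. -/
lemma IsSolution.exists_regularPath (hU0 : ∀ y, 0 ≤ U y) (hs : IsKink U a s)
    (h : IsSolution U s ψ π) :
    ∃ ψ' : ℝ → ℝ → ℝ, (∀ t, ∀ᵐ x, ψ t x = ψ' t x) ∧ RegularPath ψ' π := by
  obtain ⟨Bs, hBs, hs'⟩ := hs.exists_lintegral_deriv_le hU0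
  have holder : ∀ t B, 0 ≤ B → StateBound B (fun x => ψ t x - s x) (π t) →
      ∃ f : ℝ → ℝ, (∀ᵐ x, ψ t x = f x) ∧
        ∀ x y, (f x - f y) ^ 2 ≤ (2 * B + 2 * Bs) * |x - y| := by
    rintro t B hB ⟨_, _, _, g, hg, h4⟩
    have h5 := hg.add hs.hasWeakDeriv
    simp only [sub_add_cancel] at h5
    exact h5.exists_holder (by positivity)
      (lintegral_enorm_add_sq_le_ofReal hg.2.1.aestronglyMeasurable hB hBs h4 hs')
  have hex : ∀ t, ∃ f : ℝ → ℝ, (∀ᵐ x, ψ t x = f x) ∧ Continuous f := fun t => by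
    obtain ⟨B, hB, hB'⟩ := (h.mem_phase t).exists_stateBound
    obtain ⟨f, hf, hol⟩ := holder t B hB hB'
    exact ⟨f, hf, continuous_of_holder hol⟩
  choose ψ' hψ' hc using hex
  have mπ : ∀ t, MemLp (π t) 2 volume := fun t => by
    have := (h.mem_phase t).mem_snd
    rwa [weighted_zero] at this
  obtain ⟨Ms, hMs⟩ := hs.exists_abs_le
  have hMs0 : 0 ≤ Ms := (abs_nonneg _).trans (hMs 0)
  refine ⟨ψ', hψ', fun t => (mπ t).locallyIntegrable (by norm_num), fun T => ?_, fun t₀ => ?_,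
    fun t₀ => ?_⟩
  · obtain ⟨B, hB, hB'⟩ := h.exists_stateBound T
    refine ⟨2 * B + 2 * Bs + Ms + 2 * √B, by positivity, fun t ht => ⟨fun x y => ?_, fun x => ?_,
      ?_⟩⟩
    · obtain ⟨f, hf, hol⟩ := holder t B hB (hB' t ht)
      have e : ψ' t = f := eq_of_ae_eq_of_continuous (hc t) (continuous_of_holder hol) (by
        filter_upwards [hf, hψ' t] with x h1 h2
        rw [← h1, h2])
      rw [e]
      refine (hol x y).trans (mul_le_mul_of_nonneg_right ?_ (abs_nonneg _))
      linarith [Real.sqrt_nonneg B]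
    · have h1 := (hB' t ht).abs_le (z' := fun x => ψ' t x - s x) hB
        ((hc t).sub hs.smooth.continuous) (by
        filter_upwards [hψ' t] with x hx
        rw [hx]) x
      have h2 : |ψ' t x| ≤ |ψ' t x - s x| + |s x| := by
        simpa using abs_add_le (ψ' t x - s x) (s x)
      have := hMs x
      linarith
    · refine (hB' t ht).2.2.1.trans (ENNReal.ofReal_le_ofReal ?_)
      linarith [Real.sqrt_nonneg B]
  · refine tendsto_zero_of_sq_le (h.continuous t₀) fun t => ?_
    have e : ∫⁻ x, ‖ψ' t x - ψ' t₀ x‖ₑ ^ 2 = ∫⁻ x, ‖ψ t x - ψ t₀ x‖ₑ ^ 2 := by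
      refine lintegral_congr_ae ?_
      filter_upwards [hψ' t, hψ' t₀] with x h1 h2
      rw [h1, h2]
    rw [e, ← normL2_zero_sq]
    exact pow_le_pow_left' (normL2_le_normE_fst _ _ _) 2
  · refine tendsto_zero_of_sq_le (h.continuous t₀) fun t => ?_
    rw [← normL2_zero_sq]
    exact pow_le_pow_left' (normL2_le_normE_snd _ _ _) 2

lemma continuous_integral_mul {η : ℝ → ℝ} (hη : Continuous η) (hc : HasCompactSupport η)
    {k : ℝ → ℝ → ℝ} (hk : ∀ t, LocallyIntegrable (k t))
    (hcont : ∀ t₀, Tendsto (fun t => ∫⁻ x, ‖k t x - k t₀ x‖ₑ ^ 2) (𝓝 t₀) (𝓝 0)) :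
    Continuous fun t => ∫ x, k t x * η x := by
  have h := continuous_mol_uncurry (η := fun y => η (-y)) (by fun_prop)
    (hc.comp_homeomorph (Homeomorph.neg ℝ)) hk hcont
  have h2 := h.comp (by fun_prop : Continuous fun t : ℝ => (t, (0 : ℝ)))
  simpa [Function.comp_def, mol] using h2

lemma hasCompactSupport_mul_prod {θ η : ℝ → ℝ} (hθ : HasCompactSupport θ)
    (hη : HasCompactSupport η) : HasCompactSupport fun p : ℝ × ℝ => θ p.1 * η p.2 := by
  refine HasCompactSupport.intro (hθ.isCompact.prod hη.isCompact) fun p hp => ?_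
  by_cases h1 : p.1 ∈ tsupport θ
  · have h2 : p.2 ∉ tsupport η := fun h2 => hp ⟨h1, h2⟩
    simp [image_eq_zero_of_notMem_tsupport h2]
  · simp [image_eq_zero_of_notMem_tsupport h1]

/-- Test with products `θ(t) η(x)`: the space integrals against `η` are continuous in time and
satisfy the equations weakly in time, hence classically. -/
lemma IsSolution.exists_regularSolution (hU : ConditionU1 U a m k) (hk : 1 < k)
    (hs : IsKink U a s) (h : IsSolution U s ψ π) :
    ∃ ψ' : ℝ → ℝ → ℝ, (∀ t, ∀ᵐ x, ψ t x = ψ' t x) ∧ RegularSolution (force U) ψ' π := by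
  obtain ⟨ψ', hψ', hr⟩ := h.exists_regularPath (hU.nonneg hk) hs
  have hF := hU.contDiff_force
  have lψ : ∀ t, LocallyIntegrable (ψ' t) := fun t => (hr.continuous_fst t).locallyIntegrable
  have lF : ∀ t, LocallyIntegrable fun x => force U (ψ' t x) := fun t =>
    (hF.continuous.comp (hr.continuous_fst t)).locallyIntegrable
  refine ⟨ψ', hψ', hr, fun η hη hc => ?_, fun η hη hc => ?_⟩
  · have cα := continuous_integral_mul hη.continuous hc lψ hr.tendsto_fst
    have cβ := continuous_integral_mul hη.continuous hc hr.locallyIntegrable_snd hr.tendsto_snd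
    refine HasWeakDeriv.hasDerivAt ⟨cα.locallyIntegrable, cβ.locallyIntegrable, fun θ h1 h2 => ?_⟩
      cα cβ
    have e := h.eq_fst (fun p => θ p.1 * η p.2) (by fun_prop) (hasCompactSupport_mul_prod h2 hc)
    have e1 : ∀ t, ∫ x, ψ t x * deriv (fun τ => θ τ * η x) t =
        (∫ x, ψ' t x * η x) * deriv θ t := fun t => by
      rw [← integral_mul_const]
      refine integral_congr_ae ?_
      filter_upwards [hψ' t] with x hx
      rw [deriv_mul_const_field, hx]
      ring
    have e2 : ∀ t, ∫ x, π t x * (θ t * η x) = (∫ x, π t x * η x) * θ t := fun t => by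
      rw [← integral_mul_const]
      congr 1 with x
      ring
    simp only [e1, e2] at e
    linarith
  · have hη1 := contDiff_deriv hη
    have hη2 := contDiff_deriv hη1
    have c2 : HasCompactSupport (deriv (deriv η)) := hc.deriv.deriv
    have cα := continuous_integral_mul hη.continuous hc hr.locallyIntegrable_snd hr.tendsto_snd
    have cβ := (continuous_integral_mul hη2.continuous c2 lψ hr.tendsto_fst).add
      (continuous_integral_mul hη.continuous hc lF (hr.tendsto_force hF))
    refine HasWeakDeriv.hasDerivAt ⟨cα.locallyIntegrable, cβ.locallyIntegrable, fun θ h1 h2 => ?_⟩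
      cα cβ
    have e := h.eq_snd (fun p => θ p.1 * η p.2) (by fun_prop) (hasCompactSupport_mul_prod h2 hc)
    have e1 : ∀ t, ∫ x, π t x * deriv (fun τ => θ τ * η x) t =
        (∫ x, π t x * η x) * deriv θ t := fun t => by
      rw [← integral_mul_const]
      congr 1 with x
      rw [deriv_mul_const_field]
      ring
    have e2 : ∀ t, ∫ x, (ψ t x * iteratedDeriv 2 (fun y => θ t * η y) x +
        force U (ψ t x) * (θ t * η x)) =
        ((∫ x, ψ' t x * deriv (deriv η) x) + ∫ x, force U (ψ' t x) * η x) * θ t := fun t => by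
      have i : ∀ {f φ : ℝ → ℝ}, LocallyIntegrable f → Continuous φ → HasCompactSupport φ →
          Integrable fun x => f x * φ x := fun hf hφ hc => by
        simpa using hf.integrable_smul_right_of_hasCompactSupport hφ hc
      rw [← integral_add (i (lψ t) hη2.continuous c2) (i (lF t) hη.continuous hc),
        ← integral_mul_const]
      refine integral_congr_ae ?_
      filter_upwards [hψ' t] with x hx
      have : iteratedDeriv 2 (fun y => θ t * η y) x = θ t * deriv (deriv η) x := by
        rw [iteratedDeriv_succ, iteratedDeriv_one]
        have e3 : deriv (fun y => θ t * η y) = fun y => θ t * deriv η y :=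
          funext fun y => deriv_const_mul_field _
        rw [e3, deriv_const_mul_field]
      rw [this, hx]
      ring
    simp only [e1, e2] at e
    linarith

end Regularity

/-! ### Calculus of weighted bounds -/

section WeightedBounds

variable {P A B : ℝ} {f g : ℝ → ℝ}

lemma WeightedBound.mono (h : WeightedBound P A f) (hAB : A ≤ B) : WeightedBound P B f :=
  ⟨h.nonneg.trans hAB, h.locallyIntegrable, h.le.trans (ENNReal.ofReal_le_ofReal hAB)⟩

lemma WeightedBound.congr (h : WeightedBound P A f) (hfg : ∀ᵐ x, f x = g x) :
    WeightedBound P A g := by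
  refine ⟨h.nonneg, h.locallyIntegrable.congr hfg, le_trans (le_of_eq ?_) h.le⟩
  refine lintegral_congr_ae ?_
  filter_upwards [hfg] with x hx
  rw [hx]

lemma WeightedBound.add (h : WeightedBound P A f) (h' : WeightedBound P B g) :
    WeightedBound P (2 * A + 2 * B) fun x => f x + g x where
  nonneg := by
    have := h.nonneg
    have := h'.nonneg
    positivity
  locallyIntegrable := h.locallyIntegrable.add h'.locallyIntegrable
  le := by
    have h0 := h.nonneg
    have h0' := h'.nonneg
    refine (lintegral_enorm_add_sq_le (continuous_bracket_rpow P).measurable.ennreal_ofReal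
      h.locallyIntegrable.aestronglyMeasurable).trans ?_
    rw [ENNReal.ofReal_add (by positivity) (by positivity), ENNReal.ofReal_mul (by norm_num),
      ENNReal.ofReal_mul (by norm_num), ENNReal.ofReal_ofNat]
    have := h.le
    have := h'.le
    gcongr

lemma WeightedBound.of_sq_le (h : WeightedBound P A f) {c : ℝ} (hc : 0 ≤ c)
    (hg : LocallyIntegrable g) (hgf : ∀ x, g x ^ 2 ≤ c * f x ^ 2) : WeightedBound P (c * A) g where
  nonneg := mul_nonneg hc h.nonneg
  locallyIntegrable := hg
  le := by
    rw [ENNReal.ofReal_mul hc]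
    refine le_trans ?_ (mul_le_mul_right h.le _)
    rw [← lintegral_const_mul' _ _ ENNReal.ofReal_ne_top]
    refine lintegral_mono fun x => ?_
    rw [mul_left_comm]
    refine mul_le_mul_right ?_ _
    rw [enorm_sq_eq_ofReal, enorm_sq_eq_ofReal, ← ENNReal.ofReal_mul hc]
    exact ENNReal.ofReal_le_ofReal (hgf x)

lemma weightedBound_of_integrable (hf : Continuous f)
    (h : Integrable fun x => bracket x ^ P * f x ^ 2) :
    WeightedBound P (∫ x, bracket x ^ P * f x ^ 2) f := by
  have h0 : ∀ x, 0 ≤ bracket x ^ P := fun x => Real.rpow_nonneg (bracket_pos x).le _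
  have h1 : ∀ x, 0 ≤ bracket x ^ P * f x ^ 2 := fun x => mul_nonneg (h0 x) (sq_nonneg _)
  refine ⟨integral_nonneg h1, hf.locallyIntegrable, le_of_eq ?_⟩
  rw [ofReal_integral_eq_lintegral_ofReal h (Eventually.of_forall h1)]
  refine lintegral_congr fun x => ?_
  rw [ENNReal.ofReal_mul (h0 x), enorm_sq_eq_ofReal]

end WeightedBounds

/-! ### Uniform bounds for the initial state -/

section InitialState

variable {U : ℝ → ℝ} {a m k : ℝ} {s : ℝ → ℝ} {ψ π ψ' : ℝ → ℝ → ℝ}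

/-- The order of quantifiers matters: `A`, `M`, `C` are fixed by `U`, `s`, `σ` and `r` before the
initial state is chosen, which makes the final constant uniform. -/
lemma exists_initialBound (hU : ConditionU1 U a m k) (hk : 1 < k) (hs : IsKink U a s) {σ : ℝ}
    (hσ : 0 ≤ σ) {r : ℝ} (hr : 0 ≤ r) :
    ∃ A M C : ℝ, 0 ≤ A ∧ 0 ≤ C ∧ ∀ ψ₀ ψ₁ π₀ g : ℝ → ℝ, (∀ᵐ x, ψ₀ x = ψ₁ x) → Continuous ψ₁ →
      LocallyIntegrable π₀ → HasWeakDeriv (fun x => ψ₀ x - s x) g →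
      normL2 σ (fun x => ψ₀ x - s x) ≤ ENNReal.ofReal r → normL2 σ g ≤ ENNReal.ofReal r →
      normL2 σ π₀ ≤ ENNReal.ofReal r →
      InitialBound U (2 * σ) A M C ψ₁ π₀ (fun x => g x + deriv s x) (fun x => ψ₁ x - s x)
        (fun x => s |x| - a) := by
  obtain ⟨Ms, hMs⟩ := hs.exists_abs_le
  obtain ⟨C₁, hC₁, hU₁⟩ := hU.le_right_well hk Ms
  obtain ⟨C, hC, hU₂⟩ := hU.le_right_well hk (Ms + 2 * r)
  have cs := hs.smooth.continuous
  have hD : WeightedBound (2 * σ) (∫ x, bracket x ^ (2 * σ) * (s |x| - a) ^ 2)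
      (fun x => s |x| - a) := by
    refine weightedBound_of_integrable (by fun_prop) ?_
    simp only [bracket_rpow]
    exact hs.integrable_weight hU hk _
  set A₁ := ∫ x, bracket x ^ (2 * σ) * (s |x| - a) ^ 2
  have hA₁ := hD.nonneg
  -- The first integral `s'² = 2U(s)` and the quadratic bound at the wells dominate `s'²` by the
  -- squared distance to the wells.
  have hds : WeightedBound (2 * σ) (4 * C₁ * A₁) (deriv s) := by
    refine hD.of_sq_le (by positivity) hs.continuous_deriv.locallyIntegrable fun x => ?_
    have := hs.potential_add_le hU hC₁ hU₁ x 0 (by simpa using hMs x)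
    rw [hs.deriv_sq hU hk]
    simp only [add_zero, zero_pow two_ne_zero, zero_add] at this
    linarith
  refine ⟨2 * r ^ 2 + 2 * (4 * C₁ * A₁) + A₁, Ms + 2 * r, 2 * C, by positivity, by positivity,
    fun ψ₀ ψ₁ π₀ g he hc hπ hg hz hgr hπr => ?_⟩
  have h1 : 0 ≤ 4 * C₁ * A₁ := by positivity
  have hle : r ^ 2 ≤ 2 * r ^ 2 + 2 * (4 * C₁ * A₁) + A₁ := by nlinarith [sq_nonneg r]
  have he' : ∀ᵐ x, ψ₀ x - s x = ψ₁ x - s x := by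
    filter_upwards [he] with x hx
    rw [hx]
  have flat : ∀ {f : ℝ → ℝ}, normL2 σ f ≤ ENNReal.ofReal r →
      ∫⁻ x, ‖f x‖ₑ ^ 2 ≤ ENNReal.ofReal (r ^ 2) := fun hf => by
    rw [← normL2_zero_sq, ENNReal.ofReal_pow hr]
    exact (normL2_zero_le σ hσ _).trans (pow_le_pow_left' hf 2)
  refine
    { snd := (weightedBound_of_normL2_le hσ hπ hπr hr).mono hle
      deriv := ((weightedBound_of_normL2_le hσ hg.2.1 hgr hr).add hds).mono (by linarith)
      pert := ((weightedBound_of_normL2_le hσ hg.1 hz hr).mono hle).congr he'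
      dist := hD.mono (by nlinarith [sq_nonneg r])
      weak := by
        have := (hg.congr he').add hs.hasWeakDeriv
        simpa using this
      continuous_pert := hc.sub cs
      continuous_dist := by fun_prop
      bound := fun x => ?_
      nonneg := by positivity
      potential := fun x y hy => ?_ }
  · have hst : StateBound (r ^ 2) (fun x => ψ₀ x - s x) π₀ :=
      ⟨hπ.aestronglyMeasurable, flat hz, flat hπr, g, hg, flat hgr⟩
    have h2 := hst.abs_le (z' := fun x => ψ₁ x - s x) (by positivity) (hc.sub cs) he' x
    rw [Real.sqrt_sq hr] at h2
    have h3 : |ψ₁ x| ≤ |ψ₁ x - s x| + |s x| := by simpa using abs_add_le (ψ₁ x - s x) (s x)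
    have := hMs x
    linarith
  · have := hs.potential_add_le hU hC hU₂ x (y - s x) (by simpa using hy)
    simpa using this

end InitialState

end KinkStability

/-! ### The growth estimate -/

theorem propositionA1 (U : ℝ → ℝ) (a m k : ℝ) (hk : 1 < k)
    (hU : KinkStability.ConditionU1 U a m k)
    (s : ℝ → ℝ) (hs : KinkStability.IsKink U a s)
    (ν : ℝ) (hν : 0 < ν) (d₀ : ℝ) :
    ∃ C : ℝ, ∀ ψ π : ℝ → ℝ → ℝ, KinkStability.IsSolution U s ψ π →
      KinkStability.MemE (5 / 2 + ν) (fun x => ψ 0 x - s x) (π 0) →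
      KinkStability.normE (5 / 2 + ν) (fun x => ψ 0 x - s x) (π 0) ≤ ENNReal.ofReal d₀ →
      ∀ t : ℝ, 0 < t →
        KinkStability.normL2 (5 / 2 + ν) (fun x => ψ t x - s x) ≤
          ENNReal.ofReal (C * (1 + t) ^ (4 + ν)) := by
  open KinkStability in
  set σ := 5 / 2 + ν with hσ
  have hσ0 : 0 ≤ σ := by positivity
  -- The extra 1 makes the norm strictly smaller than `r`, as needed to pick a weak derivative from
  -- the infimum; the modulus covers negative `d₀`.
  set r := |d₀| + 1 with hr
  have hr0 : 0 ≤ r := by positivity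
  obtain ⟨A, M, C, hA, hC, hinit⟩ := exists_initialBound hU hk hs hσ0 hr0
  set E := energyConst (2 * σ) A C with hE
  have hE0 : 0 ≤ E := by
    rw [hE, energyConst]
    positivity
  set K := √(2 ^ (2 * σ) * (2 * E + 1)) with hK
  refine ⟨K + r, fun ψ π hsol _ hnorm T hT => ?_⟩
  obtain ⟨ψ', hψ', hreg⟩ := hsol.exists_regularSolution hU hk hs
  have hlt : normE σ (fun x => ψ 0 x - s x) (π 0) < ENNReal.ofReal r := by
    refine hnorm.trans_lt ((ENNReal.ofReal_lt_ofReal_iff (by positivity)).2 ?_)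
    linarith [le_abs_self d₀]
  obtain ⟨g, hg, hz, hgr⟩ := exists_weakDeriv_of_normH1_lt (le_self_add.trans_lt hlt)
  have h0 := hinit (ψ 0) (ψ' 0) (π 0) g (hψ' 0) (hreg.continuous_fst 0)
    (hreg.locallyIntegrable_snd 0) hg hz.le hgr.le
    ((normL2_le_normE_snd _ _ _).trans hlt.le)
  have hdisp := hreg.lintegral_displacement_le (hU.nonneg hk) hU.hasDerivAt hU.contDiff_force
    (by linarith) hA h0 hT.le
  have h1T : 1 ≤ 1 + T := by linarith
  have hd : normL2 σ (fun x => ψ' T x - ψ' 0 x) ≤ ENNReal.ofReal (K * (1 + T) ^ (4 + ν)) := by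
    refine le_of_sq_le_sq_ofReal (by positivity) ((normL2_sq_le hσ0 _).trans ?_)
    refine (mul_le_mul_right hdisp _).trans ?_
    rw [← ENNReal.ofReal_mul (by positivity)]
    refine ENNReal.ofReal_le_ofReal ?_
    rw [mul_pow, hK, Real.sq_sqrt (by positivity), mul_assoc (2 ^ (2 * σ))]
    refine mul_le_mul_of_nonneg_left ?_ (by positivity)
    have hp1 : 1 ≤ (1 + T) ^ (2 * σ) := Real.one_le_rpow h1T (by linarith)
    calc T ^ 2 * (2 * (1 + T) ^ (2 * σ) * E + 1)
        ≤ (1 + T) ^ 2 * ((2 * E + 1) * (1 + T) ^ (2 * σ)) := by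
          refine mul_le_mul (pow_le_pow_left₀ hT.le (by linarith) 2) ?_ (by positivity)
            (by positivity)
          linarith
      _ = (2 * E + 1) * (1 + T) ^ (2 * σ + 2) := by
          rw [Real.rpow_add (by linarith), Real.rpow_two]
          ring
      -- Here `2 * σ + 2 = 7 + 2 * ν`, below the exponent `8 + 2 * ν` on the right.
      _ ≤ (2 * E + 1) * ((1 + T) ^ (4 + ν)) ^ 2 := by
          refine mul_le_mul_of_nonneg_left ?_ (by positivity)
          rw [← Real.rpow_natCast, ← Real.rpow_mul (by linarith)]
          refine Real.rpow_le_rpow_of_exponent_le h1T ?_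
          rw [hσ]
          push_cast
          linarith
  have hsplit : normL2 σ (fun x => ψ T x - s x) =
      normL2 σ (fun x => (ψ' T x - ψ' 0 x) + (ψ' 0 x - s x)) := by
    refine eLpNorm_congr_ae ?_
    filter_upwards [hψ' T] with x hx
    simp [weighted, hx]
  have hinitial : normL2 σ (fun x => ψ' 0 x - s x) = normL2 σ (fun x => ψ 0 x - s x) := by
    refine eLpNorm_congr_ae ?_
    filter_upwards [hψ' 0] with x hx
    simp [weighted, hx]
  have c0 := hreg.continuous_fst 0
  have cT := hreg.continuous_fst T
  have cs := hs.smooth.continuous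
  rw [hsplit]
  refine (normL2_add_le σ (by fun_prop) (by fun_prop)).trans ?_
  rw [hinitial, add_mul, ENNReal.ofReal_add (by positivity) (by positivity)]
  refine add_le_add hd (hz.le.trans (ENNReal.ofReal_le_ofReal ?_))
  exact le_mul_of_one_le_right hr0 (Real.one_le_rpow h1T (by linarith))
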